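/- Let $\sigma_1=\begin{pmatrix}0&1\\1&0\end{pmatrix}$, $\sigma_2=\begin{pmatrix}0&-i\\i&0\end{pmatrix}$, $\sigma_3=\begin{pmatrix}1&0\\0&-1\end{pmatrix}$ be the Pauli matrices, let $\alpha_j=\begin{pmatrix}\mathbf 0&\sigma_j\\ \sigma_j&\mathbf 0\end{pmatrix}$ ($j=1,2,3$) be the $4\times4$ Dirac matrices, and put $\alpha\cdot v=\sum_{j=1}^3 v_j\alpha_j$ for $v \in \mathbb R^3$, $D=\frac1i\nabla_x$ on $\mathbb R^3$, and $\langle x\rangle=\sqrt{1+|x|^2}$. Let $Q(x)=(q_{jk}(x))$ be a $4\times 4$ matrix-valued function on $\mathbb R^3$ with measurable entries such that $Q(x)$ is Hermitian for each $x\in\mathbb R^3$ and, for some constants $C$ and $\rho>1$, $|q_{jk}(x)|\le C\langle x\rangle^{-\rho}$ for all $x\in\mathbb R^3$ and $j,k=1,\dots,4$. Let $f\in [H^1(\mathbb R^3)]^4$ be a zero mode of $H=\alpha\cdot D+Q$, that is, $(\alpha\cdot D)f+Qf=0$ almost everywhere, with derivatives in the weak sense. Then $Qf$ is integrable on $\mathbb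 R^3$, $f$ has a continuous representative (again denoted by $f$), and for every $\omega\in\mathbb S^2$ $$\lim_{r\to+\infty}r^2f(r\omega)=-\frac{i}{4\pi}\,(\alpha\cdot\omega)\int_{\mathbb R^3}Q(y)f(y)\,dy,$$ where the convergence is uniform with respect to $\omega\in\mathbb S^2$. -/

import Mathlib

open MeasureTheory Filter
open scoped Matrix Topology

noncomputable section

namespace ZeroMode

/-- Euclidean three-space, with Lebesgue measure as its volume. -/
abbrev E3 : Type := EuclideanSpace ℝ (Fin 3)

/-- The Japanese bracket `⟨x⟩ = √(1 + |x|²)`. -/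
def bracket (x : E3) : ℝ := Real.sqrt (1 + ‖x‖ ^ 2)

/-- The Pauli matrices. -/
def pauli : Fin 3 → Matrix (Fin 2) (Fin 2) ℂ :=
  ![!![0, 1; 1, 0], !![0, -Complex.I; Complex.I, 0], !![1, 0; 0, -1]]

/-- The Dirac matrices: the `4 × 4` matrices with zero diagonal blocks and both off-diagonal
`2 × 2` blocks equal to the corresponding Pauli matrix. -/
def alpha (j : Fin 3) : Matrix (Fin 4) (Fin 4) ℂ :=
  Matrix.reindex finSumFinEquiv finSumFinEquiv (Matrix.fromBlocks 0 (pauli j) (pauli j) 0)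

/-- `α · v = ∑ⱼ vⱼ αⱼ`. -/
def alphaDot (v : E3) : Matrix (Fin 4) (Fin 4) ℂ :=
  ∑ j : Fin 3, (v j : ℂ) • alpha j

/-- `v` is the weak (distributional) partial derivative `∂u/∂xⱼ` of `u` on `ℝ³`. -/
def HasWeakPartialDeriv (j : Fin 3) (u v : E3 → ℂ) : Prop :=
  LocallyIntegrable u ∧ LocallyIntegrable v ∧
    ∀ φ : E3 → ℝ, ContDiff ℝ ((⊤ : ℕ∞) : WithTop ℕ∞) φ → HasCompactSupport φ →
      ∫ x, u x * (fderiv ℝ φ x (EuclideanSpace.single j 1) : ℂ) = -∫ x, v x * (φ x : ℂ)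

/-- The Sobolev space `H¹(ℝ³)`: square integrable functions whose weak first partial derivatives
exist and are square integrable. -/
def MemH1 (u : E3 → ℂ) : Prop :=
  MemLp u 2 ∧ ∀ j : Fin 3, ∃ v : E3 → ℂ, MemLp v 2 ∧ HasWeakPartialDeriv j u v

/-- `h = (α · D + Q) f` almost everywhere, where `D = (1/i) ∇` is taken in the weak sense; the
function `Df j` has as its components the weak derivatives `∂f_k/∂xⱼ`, which are unique almost
everywhere. -/
def HasDiracImage (Q : E3 → Matrix (Fin 4) (Fin 4) ℂ) (f h : E3 → Fin 4 → ℂ) : Prop :=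
  ∃ Df : Fin 3 → E3 → Fin 4 → ℂ,
    (∀ j k, HasWeakPartialDeriv j (fun x => f x k) (fun x => Df j x k)) ∧
    ∀ᵐ x, h x = (∑ j : Fin 3, alpha j *ᵥ ((1 / Complex.I) • Df j x)) + Q x *ᵥ f x

/-- `f` is (a representative of) a zero mode of `H = α · D + Q`: it lies in `[H¹(ℝ³)]⁴`, the
domain of `H`, and `H f = 0`. -/
def IsZeroMode (Q : E3 → Matrix (Fin 4) (Fin 4) ℂ) (f : E3 → Fin 4 → ℂ) : Prop :=
  (∀ k, MemH1 (fun x => f x k)) ∧ HasDiracImage Q f 0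

end ZeroMode

end

noncomputable section

namespace ZeroMode

open scoped ENNReal
open Metric

/-! Put h = Qf, so (α·D)f = -h. As (α·D)² = -Δ, f should be the potential -(i/4π) ∫ α·(x-y)|x-y|⁻³
h(y) dy. Expanding this kernel at infinity gives the limit, once h decays faster than |y|⁻³.

Representation: the weak equation is tested against the difference of two smooth truncations of
z/|z|³, at scales t and R. The truncated fields have symmetric derivatives, so the anticommutation
relations leave only their divergences, which are mollifiers of mass 4π
(`integral_density_smul_eq`). As t → 0 one mollification recovers 4πf at Lebesgue points; as R → ∞
the other vanishes because f ∈ L². Without any integrability of h this already gives |f| ≤ 12 |·|⁻²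
* |h| (`ae_enorm_le_lintegral`).

Decay: with |h| ≤ 4C⟨y⟩^(-ρ)|f|, the bound becomes an integral inequality for |f| alone. Iterating
it once makes the potential bounded (`exists_lintegral_riesz_weight_le`). Each further use gains up
to ρ - 1 powers of decay, reaching every exponent below 2 (`exists_le_riesz`), so that h =
O(|y|^(-b)) with b > 3. Then `ae_eq_potential` applies, the potential is continuous, and
`tendstoUniformlyOn_sq_smul_potential` gives its leading term. -/

/-! ### Riesz kernels on ℝ³: scaling, integrability, convolution -/

/-- The Riesz kernel `|z|⁻ᵖ` on `ℝ³`, with values in `[0, ∞]`. -/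
def riesz (p : ℝ) (z : E3) : ℝ≥0∞ := ‖z‖ₑ ^ (-p)

lemma measurable_riesz (p : ℝ) : Measurable (riesz p) := by
  unfold riesz; fun_prop

lemma riesz_eq_ofReal (p : ℝ) {z : E3} (hz : z ≠ 0) :
    riesz p z = ENNReal.ofReal (‖z‖ ^ (-p)) := by
  rw [riesz, ← ofReal_norm, ENNReal.ofReal_rpow_of_pos (norm_pos_iff.2 hz)]

lemma riesz_mul_riesz (p q : ℝ) {z : E3} (hz : z ≠ 0) :
    riesz p z * riesz q z = riesz (p + q) z := by
  rw [riesz, riesz, riesz, ← ENNReal.rpow_add _ _ (by simpa using hz) (by simp)]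
  congr 1; ring

lemma riesz_smul (p : ℝ) {t : ℝ} (ht : 0 < t) (z : E3) :
    riesz p (t • z) = ENNReal.ofReal t ^ (-p) * riesz p z := by
  rw [riesz, riesz, enorm_smul, Real.enorm_eq_ofReal ht.le]
  by_cases hz : z = 0
  · subst hz
    have h1 : ENNReal.ofReal t ^ (-p) ≠ 0 := (ENNReal.rpow_pos (by simpa using ht) (by simp)).ne'
    rcases lt_trichotomy p 0 with hp | hp | hp
    · have : 0 < -p := by linarith
      simp [ENNReal.zero_rpow_of_pos this]
    · simp [hp]
    · have : -p < 0 := by linarith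
      simp only [enorm_zero, mul_zero]
      rw [ENNReal.zero_rpow_of_neg this, ENNReal.mul_top h1]
  · rw [ENNReal.mul_rpow_of_ne_top (by simp) (by simp)]

lemma lintegral_smul_eq {F : E3 → ℝ≥0∞} (hF : Measurable F) {t : ℝ} (ht : 0 < t) :
    ∫⁻ z, F z = ENNReal.ofReal t ^ (3 : ℝ) * ∫⁻ z, F (t • z) := by
  have h := Measure.map_addHaar_smul (volume : Measure E3) ht.ne'
  have h2 : ∫⁻ z, F (t • z) = ∫⁻ z, F z ∂(Measure.map (t • ·) (volume : Measure E3)) :=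
    (lintegral_map hF (measurable_const_smul t)).symm
  rw [h2, h, lintegral_smul_measure, smul_eq_mul, ← mul_assoc]
  have : ENNReal.ofReal t ^ (3 : ℝ) * ENNReal.ofReal |(t ^ Module.finrank ℝ E3)⁻¹| = 1 := by
    rw [ENNReal.ofReal_rpow_of_pos ht, ← ENNReal.ofReal_mul (by positivity)]
    have : t ^ (3 : ℝ) = t ^ 3 := by norm_cast
    rw [this, abs_of_pos (by positivity)]
    simp [finrank_euclideanSpace, ht.ne']
  rw [this, one_mul]

lemma rpow_three_mul (p : ℝ) {t : ℝ} (ht : 0 < t) :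
    ENNReal.ofReal t ^ (3 : ℝ) * ENNReal.ofReal t ^ (-p) = ENNReal.ofReal t ^ (3 - p) := by
  rw [← ENNReal.rpow_add _ _ (by simpa using ht) (by simp)]; congr 1

/-- Pure homogeneity: both sides may be ∞, so no condition on `p` is needed; finiteness is settled
on the unit ball alone. -/
lemma lintegral_riesz_ball (p : ℝ) {t : ℝ} (ht : 0 < t) :
    ∫⁻ z in ball 0 t, riesz p z = ENNReal.ofReal t ^ (3 - p) * ∫⁻ z in ball 0 1, riesz p z := by
  rw [← lintegral_indicator measurableSet_ball, ← lintegral_indicator measurableSet_ball,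
    lintegral_smul_eq ((measurable_riesz p).indicator measurableSet_ball) ht,
    ← rpow_three_mul p ht, mul_assoc]
  congr 1
  rw [← lintegral_const_mul _ ((measurable_riesz p).indicator measurableSet_ball)]
  congr 1; ext z
  have : t • z ∈ ball (0 : E3) t ↔ z ∈ ball (0 : E3) 1 := by
    simp [norm_smul, abs_of_pos ht, ht]
  by_cases hz : z ∈ ball (0 : E3) 1
  · rw [Set.indicator_of_mem hz, Set.indicator_of_mem (this.2 hz), riesz_smul p ht]
  · rw [Set.indicator_of_notMem hz, Set.indicator_of_notMem (fun h => hz (this.1 h)), mul_zero]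

lemma lintegral_riesz_compl_ball (p : ℝ) {t : ℝ} (ht : 0 < t) :
    ∫⁻ z in (ball 0 t)ᶜ, riesz p z =
      ENNReal.ofReal t ^ (3 - p) * ∫⁻ z in (ball 0 1)ᶜ, riesz p z := by
  rw [← lintegral_indicator measurableSet_ball.compl,
    ← lintegral_indicator measurableSet_ball.compl,
    lintegral_smul_eq ((measurable_riesz p).indicator measurableSet_ball.compl) ht,
    ← rpow_three_mul p ht, mul_assoc]
  congr 1
  rw [← lintegral_const_mul _ ((measurable_riesz p).indicator measurableSet_ball.compl)]
  congr 1; ext z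
  have : t • z ∈ (ball (0 : E3) t)ᶜ ↔ z ∈ (ball (0 : E3) 1)ᶜ := by
    simp [norm_smul, abs_of_pos ht, ht]
  by_cases hz : z ∈ (ball (0 : E3) 1)ᶜ
  · rw [Set.indicator_of_mem hz, Set.indicator_of_mem (this.2 hz), riesz_smul p ht]
  · rw [Set.indicator_of_notMem hz, Set.indicator_of_notMem (fun h => hz (this.1 h)), mul_zero]

lemma ae_ne_zero : ∀ᵐ z : E3, z ≠ 0 := by
  simp [ae_iff]

lemma lintegral_riesz_unitBall_ne_top {p : ℝ} (hp : p < 3) :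
    ∫⁻ z in ball (0 : E3) 1, riesz p z ≠ ∞ := by
  have h : IntegrableOn (fun z : E3 => ‖z‖ ^ (-p)) (ball 0 1) volume := by
    refine integrableOn_ball_of_norm_le_rpow (C := 1) (α := p) (by simp) (by simpa using hp) ?_ ?_
    · refine ae_of_all _ fun z => ?_
      rw [Real.norm_of_nonneg (by positivity), one_mul]
    · exact (by fun_prop : Measurable fun z : E3 => ‖z‖ ^ (-p)).aestronglyMeasurable
  have h2 := h.lintegral_lt_top
  refine (lt_of_le_of_lt (lintegral_mono_ae ?_) h2).ne
  filter_upwards [ae_restrict_of_ae ae_ne_zero] with z hz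
  rw [riesz_eq_ofReal p hz]

lemma lintegral_riesz_compl_unitBall_ne_top {p : ℝ} (hp : 3 < p) :
    ∫⁻ z in (ball (0 : E3) 1)ᶜ, riesz p z ≠ ∞ := by
  have h : Integrable (fun z : E3 => (Set.Ici (1 : ℝ)).indicator (fun r => r ^ (-p)) ‖z‖) := by
    rw [integrable_fun_norm_addHaar (volume : Measure E3)
      (f := (Set.Ici (1 : ℝ)).indicator (fun r => r ^ (-p)))]
    have h1 : IntegrableOn (fun r : ℝ => r ^ (2 - p)) (Set.Ici 1) := by
      rw [integrableOn_Ici_iff_integrableOn_Ioi]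
      exact integrableOn_Ioi_rpow_of_lt (by linarith) one_pos
    have h2 : Integrable ((Set.Ici (1 : ℝ)).indicator fun r : ℝ => r ^ (2 - p)) := by
      rwa [integrable_indicator_iff measurableSet_Ici]
    refine h2.integrableOn.congr_fun (fun r _ => ?_) measurableSet_Ioi
    by_cases hr : r ∈ Set.Ici (1 : ℝ)
    · have hr0 : 0 < r := lt_of_lt_of_le one_pos hr
      simp only [Set.indicator_of_mem hr, smul_eq_mul, finrank_euclideanSpace, Fintype.card_fin]
      rw [sub_eq_add_neg, Real.rpow_add hr0]
      norm_num
    · simp only [Set.indicator_of_notMem hr, smul_zero]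
  refine (lt_of_le_of_lt ?_ h.lintegral_lt_top).ne
  rw [← lintegral_indicator measurableSet_ball.compl]
  refine lintegral_mono fun z => ?_
  by_cases hz : z ∈ (ball (0 : E3) 1)ᶜ
  · have h1 : 1 ≤ ‖z‖ := by simpa using hz
    rw [Set.indicator_of_mem hz, Set.indicator_of_mem (by exact h1),
      riesz_eq_ofReal p (norm_pos_iff.1 (by linarith))]
  · simp [Set.indicator_of_notMem hz]

/-- The singularities of a product of two Riesz kernels, separated at the scale `t`. -/
lemma rpow_neg_mul_rpow_neg_le {p q : ℝ} (hp : 0 < p) (hq : 0 < q) {u v t : ℝ≥0∞}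
    (h : t ≤ u ∨ t ≤ v) :
    u ^ (-p) * v ^ (-q) ≤ (if u < t then u ^ (-p) * t ^ (-q) else u ^ (-(p + q))) +
      (if v < t then v ^ (-q) * t ^ (-p) else v ^ (-(p + q))) := by
  have anti : ∀ {r : ℝ}, 0 < r → ∀ {a b : ℝ≥0∞}, a ≤ b → b ^ (-r) ≤ a ^ (-r) := by
    intro r hr a b hab
    rw [ENNReal.rpow_neg, ENNReal.rpow_neg]
    exact ENNReal.inv_le_inv.2 (ENNReal.rpow_le_rpow hab hr.le)
  have spl : ∀ {a b : ℝ≥0∞}, a ≤ b → ∀ {r s : ℝ}, 0 < r → 0 < s →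
      a ^ (-r) * b ^ (-s) ≤ a ^ (-(r + s)) := by
    intro a b hab r s hr hs
    refine (mul_le_mul_right (anti hs hab) _).trans ?_
    rcases eq_or_ne a 0 with rfl | h0
    · rw [ENNReal.zero_rpow_of_neg (show -(r + s) < 0 by linarith)]; exact le_top
    rcases eq_or_ne a ∞ with rfl | h1
    · rw [ENNReal.top_rpow_of_neg (by linarith)]; simp
    rw [← ENNReal.rpow_add _ _ h0 h1, neg_add]
  -- At most one variable lies below `t`; the other factor is then at most its value at `t`. If
  -- neither does, the smaller variable controls the product.
  rcases lt_or_ge u t with hu | hu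
  · have hv : t ≤ v := h.resolve_left (not_le.2 hu)
    rw [if_pos hu]
    exact (mul_le_mul_right (anti hq hv) _).trans le_self_add
  · rcases lt_or_ge v t with hv | hv
    · rw [if_pos hv, mul_comm (u ^ (-p))]
      exact (mul_le_mul_right (anti hp hu) _).trans le_add_self
    · rw [if_neg (not_lt.2 hu), if_neg (not_lt.2 hv)]
      rcases le_total u v with huv | huv
      · exact (spl huv hp hq).trans le_self_add
      · rw [mul_comm, add_comm p q]
        exact (spl huv hq hp).trans le_add_self

/-- The singular part contributes t^(3-p)·t^(-q) and the tail t^(3-(p+q)): the same power of `t`. -/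
lemma lintegral_ite_riesz {p q : ℝ} {t : ℝ} (ht : 0 < t) :
    ∫⁻ z : E3, (if ‖z‖ₑ < ENNReal.ofReal t then riesz p z * ENNReal.ofReal t ^ (-q)
        else riesz (p + q) z) =
      ENNReal.ofReal t ^ (3 - p - q) *
        ((∫⁻ z in ball 0 1, riesz p z) + ∫⁻ z in (ball 0 1)ᶜ, riesz (p + q) z) := by
  have hiff : ∀ z : E3, ‖z‖ₑ < ENNReal.ofReal t ↔ z ∈ ball (0 : E3) t := by
    intro z
    rw [← ofReal_norm, ENNReal.ofReal_lt_ofReal_iff ht]; simp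
  rw [← lintegral_add_compl _ (measurableSet_ball (x := (0 : E3)) (ε := t))]
  rw [setLIntegral_congr_fun (g := fun z => riesz p z * ENNReal.ofReal t ^ (-q))
    measurableSet_ball (fun z hz => by simp only [if_pos ((hiff z).2 hz)]),
    setLIntegral_congr_fun (g := fun z => riesz (p + q) z)
    measurableSet_ball.compl (fun z hz => by
      simp only [if_neg (fun h => hz ((hiff z).1 h))])]
  rw [lintegral_mul_const _ (measurable_riesz p), lintegral_riesz_ball p ht,
    lintegral_riesz_compl_ball (p + q) ht, mul_add, sub_sub]
  congr 1
  rw [mul_right_comm, ← ENNReal.rpow_add _ _ (by simpa using ht) (by simp)]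
  congr 2; ring

lemma measurable_ite_riesz (p q t : ℝ) :
    Measurable fun z : E3 => (if ‖z‖ₑ < ENNReal.ofReal t then riesz p z * ENNReal.ofReal t ^ (-q)
        else riesz (p + q) z) :=
  Measurable.ite (measurableSet_lt measurable_enorm measurable_const)
    ((measurable_riesz p).mul_const _) (measurable_riesz _)

/-- `∫ |x - y|⁻ᵖ |y|⁻^q dy ≤ C |x|^(3 - p - q)`. -/
lemma exists_lintegral_riesz_mul_riesz_le {p q : ℝ} (hp : 0 < p) (hp3 : p < 3) (hq : 0 < q)
    (hq3 : q < 3) (hpq : 3 < p + q) :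
    ∃ C : ℝ≥0∞, C ≠ ∞ ∧ ∀ x : E3, x ≠ 0 →
      ∫⁻ y, riesz p (x - y) * riesz q y ≤ C * riesz (p + q - 3) x := by
  refine ⟨ENNReal.ofReal 2⁻¹ ^ (3 - p - q) *
    (((∫⁻ z in ball 0 1, riesz p z) + ∫⁻ z in (ball 0 1)ᶜ, riesz (p + q) z) +
    ((∫⁻ z in ball 0 1, riesz q z) + ∫⁻ z in (ball 0 1)ᶜ, riesz (q + p) z)), ?_, fun x hx => ?_⟩
  · refine ENNReal.mul_ne_top (by
      rw [ENNReal.ofReal_rpow_of_pos (by norm_num)]; exact ENNReal.ofReal_ne_top) ?_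
    simp only [ne_eq, ENNReal.add_eq_top, not_or]
    exact ⟨⟨lintegral_riesz_unitBall_ne_top hp3, lintegral_riesz_compl_unitBall_ne_top hpq⟩,
      lintegral_riesz_unitBall_ne_top hq3, lintegral_riesz_compl_unitBall_ne_top (by linarith)⟩
  have hx0 : 0 < ‖x‖ := norm_pos_iff.2 hx
  -- The splitting scale is |x|/2: by the triangle inequality |x - y| and |y| cannot both be
  -- smaller.
  have ht : 0 < 2⁻¹ * ‖x‖ := by positivity
  have key : ∀ y : E3, riesz p (x - y) * riesz q y ≤ _ := fun y =>
    rpow_neg_mul_rpow_neg_le hp hq (u := ‖x - y‖ₑ) (v := ‖y‖ₑ)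
      (t := ENNReal.ofReal (2⁻¹ * ‖x‖)) (by
        rw [← ofReal_norm, ← ofReal_norm]
        rcases le_total (2⁻¹ * ‖x‖) ‖y‖ with h | h
        · exact Or.inr (ENNReal.ofReal_le_ofReal h)
        · left
          refine ENNReal.ofReal_le_ofReal ?_
          have := norm_sub_norm_le x y
          linarith)
  refine (lintegral_mono key).trans ?_
  have e1 := lintegral_ite_riesz (p := p) (q := q) ht
  have e2 := lintegral_ite_riesz (p := q) (q := p) ht
  rw [← lintegral_sub_left_eq_self _ x] at e1
  have m1 := (measurable_ite_riesz p q (2⁻¹ * ‖x‖)).comp (measurable_const_sub x)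
  simp only [riesz, add_comm q p, Function.comp_def] at e1 e2 m1 ⊢
  rw [lintegral_add_left m1, e1, e2, sub_right_comm 3 q p, ← mul_add,
    ENNReal.ofReal_mul (by positivity), ENNReal.mul_rpow_of_ne_top (by simp) (by simp),
    ofReal_norm]
  rw [show -(p + q - 3) = 3 - p - q by ring]
  rw [mul_right_comm]

lemma exists_lintegral_riesz_two_mul_riesz_two_le :
    ∃ C : ℝ≥0∞, C ≠ ∞ ∧ ∀ x : E3, x ≠ 0 →
      ∫⁻ y, riesz 2 (x - y) * riesz 2 y ≤ C * riesz 1 x := by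
  have := exists_lintegral_riesz_mul_riesz_le (p := 2) (q := 2) (by norm_num) (by norm_num)
    (by norm_num) (by norm_num) (by norm_num)
  norm_num at this
  simpa using this

/-- `min 1 |y|⁻²` convolved with `|y|⁻²` is bounded. -/
lemma exists_lintegral_riesz_mul_min_le :
    ∃ C : ℝ≥0∞, C ≠ ∞ ∧ ∀ x : E3, ∫⁻ y, riesz 2 (x - y) * min 1 (riesz 2 y) ≤ C := by
  -- Splitting at scale 1: |x-y|⁻² near `x`, the constant 1 near the origin (exponent 0), and the
  -- fourth inverse powers elsewhere.
  refine ⟨((∫⁻ z in ball 0 1, riesz 2 z) + ∫⁻ z in (ball 0 1)ᶜ, riesz (2 + 2) z) +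
    ((∫⁻ z in ball 0 1, riesz 0 z) + ∫⁻ z in (ball 0 1)ᶜ, riesz (0 + 4) z), ?_, fun x => ?_⟩
  · simp only [ne_eq, ENNReal.add_eq_top, not_or]
    exact ⟨⟨lintegral_riesz_unitBall_ne_top (by norm_num),
      lintegral_riesz_compl_unitBall_ne_top (by norm_num)⟩,
      lintegral_riesz_unitBall_ne_top (by norm_num),
      lintegral_riesz_compl_unitBall_ne_top (by norm_num)⟩
  have e1 := lintegral_ite_riesz (p := 2) (q := 2) one_pos
  have e2 := lintegral_ite_riesz (p := 0) (q := 4) one_pos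
  rw [← lintegral_sub_left_eq_self _ x] at e1
  have m1 := (measurable_ite_riesz 2 2 1).comp (measurable_const_sub x)
  simp only [ENNReal.ofReal_one, ENNReal.one_rpow, mul_one, one_mul, Function.comp_def]
    at e1 e2 m1
  rw [← e1, ← e2, ← lintegral_add_left m1]
  refine lintegral_mono fun y => ?_
  have hle : ∀ {z : E3}, ¬ ‖z‖ₑ < 1 → riesz 2 z ≤ 1 := by
    intro z hz
    rw [riesz, ENNReal.rpow_neg]
    exact ENNReal.inv_le_one.2 (ENNReal.one_le_rpow (not_lt.1 hz) (by norm_num))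
  by_cases hu : ‖x - y‖ₑ < 1
  · rw [if_pos hu]
    exact (mul_le_of_le_one_right' (min_le_left _ _)).trans le_self_add
  by_cases hv : ‖y‖ₑ < 1
  · rw [if_pos hv]
    refine le_trans ?_ le_add_self
    have : riesz 0 y = 1 := by simp [riesz]
    rw [this]
    exact mul_le_one' (hle hu) (min_le_left _ _)
  rw [if_neg hu, if_neg hv]
  have := rpow_neg_mul_rpow_neg_le (p := 2) (q := 2) (by norm_num) (by norm_num)
    (u := ‖x - y‖ₑ) (v := ‖y‖ₑ) (t := 1) (Or.inl (not_lt.1 hu))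
  rw [if_neg hu, if_neg hv] at this
  refine (mul_le_mul_right (min_le_right _ _) _).trans (this.trans ?_)
  norm_num [riesz]

/-- `min 1 |y|⁻ᵇ` is integrable for `b > 3`. -/
lemma lintegral_min_riesz_ne_top {b : ℝ} (hb : 3 < b) :
    ∫⁻ y : E3, min 1 (riesz b y) ≠ ∞ := by
  rw [← lintegral_add_compl _ (measurableSet_ball (x := (0 : E3)) (ε := 1))]
  refine ENNReal.add_ne_top.2 ⟨?_, ?_⟩
  · refine (lt_of_le_of_lt (lintegral_mono fun y => min_le_left _ _) ?_).ne
    simp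
  · exact (lt_of_le_of_lt (lintegral_mono fun y => min_le_right _ _)
      (lintegral_riesz_compl_unitBall_ne_top hb).lt_top).ne

/-! ### Algebra and bounds for the Dirac matrices -/

lemma alpha_zero : alpha 0 = !![0, 0, 0, 1; 0, 0, 1, 0; 0, 1, 0, 0; 1, 0, 0, 0] := by
  ext i k
  fin_cases i <;> fin_cases k <;> rfl

lemma alpha_one : alpha 1 = !![0, 0, 0, -Complex.I; 0, 0, Complex.I, 0;
    0, -Complex.I, 0, 0; Complex.I, 0, 0, 0] := by
  ext i k
  fin_cases i <;> fin_cases k <;> rfl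

lemma alpha_two : alpha 2 = !![0, 0, 1, 0; 0, 0, 0, -1; 1, 0, 0, 0; 0, -1, 0, 0] := by
  ext i k
  fin_cases i <;> fin_cases k <;> rfl

/-- The anticommutation relations, contracted with a symmetric tensor. -/
lemma sum_smul_alpha_mul_alpha (S : Fin 3 → Fin 3 → ℂ) (hS : ∀ m j, S m j = S j m) :
    ∑ m, ∑ j, S m j • (alpha m * alpha j) = (∑ j, S j j) • (1 : Matrix (Fin 4) (Fin 4) ℂ) := by
  simp only [Fin.sum_univ_three, alpha_zero, alpha_one, alpha_two]
  rw [hS 1 0, hS 2 0, hS 2 1]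
  ext i k
  fin_cases i <;> fin_cases k <;>
    simp [Matrix.smul_apply] <;> ring

lemma norm_alpha_apply_le (j : Fin 3) (k l : Fin 4) : ‖alpha j k l‖ ≤ 1 := by
  fin_cases j
  · change ‖alpha 0 k l‖ ≤ 1
    rw [alpha_zero]; fin_cases k <;> fin_cases l <;> simp
  · change ‖alpha 1 k l‖ ≤ 1
    rw [alpha_one]; fin_cases k <;> fin_cases l <;> simp
  · change ‖alpha 2 k l‖ ≤ 1
    rw [alpha_two]; fin_cases k <;> fin_cases l <;> simp

lemma norm_mulVec_le {M : Matrix (Fin 4) (Fin 4) ℂ} {c : ℝ} (hM : ∀ k l, ‖M k l‖ ≤ c)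
    (u : Fin 4 → ℂ) : ‖M *ᵥ u‖ ≤ 4 * c * ‖u‖ := by
  have hc : 0 ≤ c := (norm_nonneg _).trans (hM 0 0)
  refine (pi_norm_le_iff_of_nonneg (by positivity)).2 fun k => ?_
  calc ‖(M *ᵥ u) k‖ = ‖∑ l, M k l * u l‖ := rfl
    _ ≤ ∑ l, ‖M k l * u l‖ := norm_sum_le _ _
    _ ≤ ∑ _l : Fin 4, c * ‖u‖ := Finset.sum_le_sum fun l _ => by
        rw [norm_mul]
        exact mul_le_mul (hM k l) (norm_le_pi_norm u l) (norm_nonneg _) hc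
    _ = 4 * c * ‖u‖ := by simp; ring

lemma norm_alphaDot_mulVec_le (v : E3) (u : Fin 4 → ℂ) :
    ‖alphaDot v *ᵥ u‖ ≤ 12 * ‖v‖ * ‖u‖ := by
  have h : ∀ k l, ‖alphaDot v k l‖ ≤ 3 * ‖v‖ := by
    intro k l
    rw [alphaDot, Matrix.sum_apply]
    refine (norm_sum_le _ _).trans ?_
    calc ∑ j, ‖((v j : ℂ) • alpha j) k l‖ ≤ ∑ _j : Fin 3, ‖v‖ := Finset.sum_le_sum fun j _ => by
          rw [Matrix.smul_apply, smul_eq_mul, norm_mul, Complex.norm_real]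
          exact (mul_le_of_le_one_right (norm_nonneg _) (norm_alpha_apply_le j k l)).trans
            (PiLp.norm_apply_le v j)
      _ = 3 * ‖v‖ := by simp
  refine (norm_mulVec_le h u).trans (le_of_eq (by ring))

lemma alphaDot_smul (c : ℝ) (v : E3) : alphaDot (c • v) = (c : ℂ) • alphaDot v := by
  simp only [alphaDot, Finset.smul_sum, smul_smul, PiLp.smul_apply, smul_eq_mul,
    Complex.ofReal_mul]

lemma alphaDot_sub (v w : E3) : alphaDot (v - w) = alphaDot v - alphaDot w := by
  simp [alphaDot, sub_smul, Finset.sum_sub_distrib]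

lemma continuous_alphaDot : Continuous alphaDot := by
  unfold alphaDot
  fun_prop

lemma integrable_mulVec (M : Matrix (Fin 4) (Fin 4) ℂ) {v : E3 → Fin 4 → ℂ}
    (hv : Integrable v) : Integrable fun x => M *ᵥ v x :=
  (LinearMap.toContinuousLinearMap M.mulVecLin).integrable_comp hv

lemma integral_mulVec (M : Matrix (Fin 4) (Fin 4) ℂ) {v : E3 → Fin 4 → ℂ} (hv : Integrable v) :
    ∫ x, M *ᵥ v x = M *ᵥ ∫ x, v x :=
  (LinearMap.toContinuousLinearMap M.mulVecLin).integral_comp_comm hv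

/-! ### The weak equation tested against a vector field -/

/-- Testing `(α · D) f = -h` against a compactly supported smooth field with symmetric
derivative. -/
lemma integral_div_smul_eq {f h : E3 → Fin 4 → ℂ} {Df : Fin 3 → E3 → Fin 4 → ℂ}
    (hD : ∀ j k, HasWeakPartialDeriv j (fun x => f x k) (fun x => Df j x k))
    (heq : ∀ᵐ x, 0 = (∑ j : Fin 3, alpha j *ᵥ ((1 / Complex.I) • Df j x)) + h x)
    (Φ : E3 → E3) (hΦ : ContDiff ℝ ((⊤ : ℕ∞) : WithTop ℕ∞) Φ) (hc : HasCompactSupport Φ)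
    (S : Fin 3 → Fin 3 → E3 → ℝ)
    (hS : ∀ m j y, fderiv ℝ (fun y => Φ y m) y (EuclideanSpace.single j 1) = S m j y)
    (hsymm : ∀ m j y, S m j y = S j m y) :
    ∫ y, ((∑ j, S j j y : ℝ) : ℂ) • f y = Complex.I • ∫ y, alphaDot (Φ y) *ᵥ h y := by
  have hΦm : ∀ m, ContDiff ℝ ((⊤ : ℕ∞) : WithTop ℕ∞) (fun y => Φ y m) := fun m =>
    (EuclideanSpace.proj m : E3 →L[ℝ] ℝ).contDiff.comp hΦ
  have hcm : ∀ m, HasCompactSupport (fun y => Φ y m) := fun m =>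
    hc.comp_left (g := fun v : E3 => v m) rfl
  have hcS : ∀ m j, Continuous (S m j) ∧ HasCompactSupport (S m j) := by
    intro m j
    have e : S m j = fun y => fderiv ℝ (fun y => Φ y m) y (EuclideanSpace.single j 1) := by
      ext y; rw [hS]
    rw [e]
    exact ⟨((hΦm m).continuous_fderiv (by simp)).clm_apply continuous_const,
      ((hcm m).fderiv ℝ).comp_left (g := fun L : E3 →L[ℝ] ℝ => L (EuclideanSpace.single j 1)) rfl⟩
  have hfl : LocallyIntegrable f := by
    rw [locallyIntegrable_iff]
    intro K hK
    exact Integrable.of_eval fun k => (hD 0 k).1.integrableOn_isCompact hK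
  have hDl : ∀ j, LocallyIntegrable (Df j) := by
    intro j
    rw [locallyIntegrable_iff]
    intro K hK
    exact Integrable.of_eval fun k => (hD j k).2.1.integrableOn_isCompact hK
  have intg : ∀ {v : E3 → Fin 4 → ℂ}, LocallyIntegrable v → ∀ {φ : E3 → ℝ}, Continuous φ →
      HasCompactSupport φ → Integrable fun y => (φ y : ℂ) • v y := by
    intro v hv φ h1 h2
    exact hv.integrable_smul_left_of_hasCompactSupport (Complex.continuous_ofReal.comp h1)
      (h2.comp_left (g := fun r : ℝ => (r : ℂ)) rfl)
  have weak : ∀ m j, ∫ y, (S m j y : ℂ) • f y = -∫ y, (Φ y m : ℂ) • Df j y := by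
    intro m j
    ext k
    have hk := (hD j k).2.2 (fun y => Φ y m) (hΦm m) (hcm m)
    rw [Pi.neg_apply, eval_integral (fun i => (intg hfl (hcS m j).1 (hcS m j).2).eval i),
      eval_integral (fun i => (intg (hDl j) (hΦm m).continuous (hcm m)).eval i)]
    simp only [hS] at hk
    simp only [Pi.smul_apply, smul_eq_mul]
    simpa only [mul_comm] using hk
  -- The contracted anticommutation relations, read backwards, turn (div Φ) f into a double sum.
  -- After integration by parts its inner sum over `j` is α·∇f.
  have step : ∀ y, ((∑ j, S j j y : ℝ) : ℂ) • f y =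
      ∑ m, ∑ j, (alpha m * alpha j) *ᵥ ((S m j y : ℂ) • f y) := by
    intro y
    have := sum_smul_alpha_mul_alpha (fun m j => (S m j y : ℂ)) (fun m j => by rw [hsymm])
    have h2 := congrArg (fun M => M *ᵥ f y) this
    simp only [Matrix.sum_mulVec, Matrix.smul_mulVec, Matrix.one_mulVec] at h2
    simp only [Matrix.mulVec_smul, h2]
    push_cast; rfl
  have hint : ∀ m j, Integrable fun y => (alpha m * alpha j) *ᵥ ((S m j y : ℂ) • f y) :=
    fun m j => integrable_mulVec _ (intg hfl (hcS m j).1 (hcS m j).2)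
  have hint2 : ∀ m j, Integrable fun y => (alpha m * alpha j) *ᵥ ((Φ y m : ℂ) • Df j y) :=
    fun m j => integrable_mulVec _ (intg (hDl j) (hΦm m).continuous (hcm m))
  simp only [step]
  rw [integral_finsetSum _ fun m _ => integrable_finsetSum _ fun j _ => hint m j]
  have e1 : ∀ m, ∫ y, ∑ j, (alpha m * alpha j) *ᵥ ((S m j y : ℂ) • f y) =
      -∫ y, ∑ j, (alpha m * alpha j) *ᵥ ((Φ y m : ℂ) • Df j y) := by
    intro m
    rw [integral_finsetSum _ fun j _ => hint m j, integral_finsetSum _ fun j _ => hint2 m j,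
      ← Finset.sum_neg_distrib]
    refine Finset.sum_congr rfl fun j _ => ?_
    rw [integral_mulVec _ (intg hfl (hcS m j).1 (hcS m j).2),
      integral_mulVec _ (intg (hDl j) (hΦm m).continuous (hcm m)), weak, Matrix.mulVec_neg]
  simp only [e1, Finset.sum_neg_distrib]
  rw [← integral_finsetSum _ fun m _ => integrable_finsetSum _ fun j _ => hint2 m j,
    ← integral_neg, ← integral_smul]
  refine integral_congr_ae ?_
  filter_upwards [heq] with y hy
  -- Since 1/i = -i, the equation reads α·∇f = -ih.
  have hy2 : ∑ j, alpha j *ᵥ Df j y = (-Complex.I) • h y := by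
    have h3 : h y = -∑ j : Fin 3, alpha j *ᵥ ((1 / Complex.I) • Df j y) :=
      eq_neg_of_add_eq_zero_right hy.symm
    rw [h3]
    simp only [Matrix.mulVec_smul, ← Finset.smul_sum]
    rw [smul_neg, neg_smul, neg_neg, smul_smul]
    simp
  have h4 : ∀ m, ∑ j, (alpha m * alpha j) *ᵥ ((Φ y m : ℂ) • Df j y) =
      (-Complex.I) • (((Φ y m : ℂ) • alpha m) *ᵥ h y) := by
    intro m
    simp only [Matrix.mulVec_smul, ← Finset.smul_sum, ← Matrix.mulVec_mulVec]
    rw [← Matrix.mulVec_sum, hy2, Matrix.mulVec_smul, Matrix.smul_mulVec, smul_comm]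
  simp only [h4, ← Finset.smul_sum, ← Matrix.sum_mulVec, alphaDot]
  rw [neg_smul, neg_neg]

/-! ### Smooth truncations of z/|z|³ and their divergence -/

/-- A smooth function on `ℝ` that vanishes for `s ≤ 1` and equals `s ^ (-3/2)` for `s ≥ 2`. -/
def profile (s : ℝ) : ℝ := Real.smoothTransition (s - 1) * s ^ (-(3 / 2) : ℝ)

lemma profile_of_le_one {s : ℝ} (hs : s ≤ 1) : profile s = 0 := by
  rw [profile, Real.smoothTransition.zero_of_nonpos (by linarith), zero_mul]

lemma profile_of_two_le {s : ℝ} (hs : 2 ≤ s) : profile s = s ^ (-(3 / 2) : ℝ) := by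
  rw [profile, Real.smoothTransition.one_of_one_le (by linarith), one_mul]

lemma profile_nonneg (s : ℝ) : 0 ≤ profile s := by
  rcases le_or_gt s 1 with h | h
  · rw [profile_of_le_one h]
  · exact mul_nonneg (Real.smoothTransition.nonneg _) (by positivity)

lemma profile_le {s : ℝ} (hs : 0 ≤ s) : profile s ≤ s ^ (-(3 / 2) : ℝ) :=
  mul_le_of_le_one_left (by positivity) (Real.smoothTransition.le_one _)

lemma contDiff_profile : ContDiff ℝ ((⊤ : ℕ∞) : WithTop ℕ∞) profile := by
  rw [contDiff_iff_contDiffAt]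
  intro s
  rcases lt_or_ge s 1 with h | h
  · have : profile =ᶠ[𝓝 s] fun _ => 0 := by
      filter_upwards [Iio_mem_nhds h] with r hr
      exact profile_of_le_one (le_of_lt hr)
    exact contDiffAt_const.congr_of_eventuallyEq this
  · have h0 : s ≠ 0 := by linarith
    exact (Real.smoothTransition.contDiffAt.comp s (contDiffAt_id.sub contDiffAt_const)).mul
      (Real.contDiffAt_rpow_const_of_ne h0)

lemma hasDerivAt_profile (s : ℝ) : HasDerivAt profile (deriv profile s) s :=
  (contDiff_profile.differentiable (by simp) s).hasDerivAt

lemma deriv_profile_of_two_lt {s : ℝ} (hs : 2 < s) :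
    deriv profile s = -(3 / 2) * s ^ (-(5 / 2) : ℝ) := by
  have : profile =ᶠ[𝓝 s] fun r => r ^ (-(3 / 2) : ℝ) := by
    filter_upwards [Ioi_mem_nhds hs] with r hr
    exact profile_of_two_le (le_of_lt hr)
  rw [this.deriv_eq, Real.deriv_rpow_const]
  norm_num

/-- The radial profile of the divergence of `z ↦ profile (|z|²) z`. -/
def densityProfile (r : ℝ) : ℝ := 3 * profile (r ^ 2) + 2 * r ^ 2 * deriv profile (r ^ 2)

lemma continuous_densityProfile : Continuous densityProfile := by
  have h1 := contDiff_profile.continuous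
  have h2 := contDiff_profile.continuous_deriv (by simp)
  unfold densityProfile
  fun_prop

/-- The field z/|z|³ is divergence free away from 0, and for r ≥ 2 the truncation is exact near r,
since r² > 2. -/
lemma densityProfile_of_two_le {r : ℝ} (hr : 2 ≤ r) : densityProfile r = 0 := by
  have h : 2 < r ^ 2 := by nlinarith
  have h0 : 0 < r ^ 2 := by linarith
  rw [densityProfile, profile_of_two_le h.le, deriv_profile_of_two_lt h]
  have : (r ^ 2) ^ (-(3 / 2) : ℝ) = r ^ 2 * (r ^ 2) ^ (-(5 / 2) : ℝ) := by
    nth_rw 2 [← Real.rpow_one (r ^ 2)]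
    rw [← Real.rpow_add h0]
    norm_num
  rw [this]; ring

lemma exists_abs_densityProfile_le : ∃ D : ℝ, 0 < D ∧ ∀ r, 0 ≤ r → |densityProfile r| ≤ D := by
  obtain ⟨D, hD⟩ := (isCompact_Icc (a := (0 : ℝ)) (b := 2)).exists_bound_of_continuousOn
    continuous_densityProfile.continuousOn
  refine ⟨|D| + 1, by positivity, fun r hr => ?_⟩
  rcases le_or_gt r 2 with h | h
  · exact ((hD r ⟨hr, h⟩).trans (le_abs_self D)).trans (by linarith)
  · rw [densityProfile_of_two_le h.le, abs_zero]; positivity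

/-- Divergence theorem in radial form: the integrand is the derivative of r³·`profile`(r²), which is
0 at r = 0 and 1 at r = 2. -/
lemma integral_sq_mul_densityProfile :
    ∫ r in Set.Ioi (0 : ℝ), r ^ 2 * densityProfile r = 1 := by
  have hd : ∀ r ∈ Set.uIcc (0 : ℝ) 2,
      HasDerivAt (fun r => r ^ 3 * profile (r ^ 2)) (r ^ 2 * densityProfile r) r := by
    intro r _
    have h1 : HasDerivAt (fun r : ℝ => r ^ 2) (2 * r) r := by simpa using hasDerivAt_pow 2 r
    have h2 : HasDerivAt (fun r : ℝ => r ^ 3) (3 * r ^ 2) r := by simpa using hasDerivAt_pow 3 r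
    have h3 := (hasDerivAt_profile (r ^ 2)).comp r h1
    refine (h2.mul h3).congr_deriv ?_
    simp only [densityProfile, Function.comp]; ring
  have hc : Continuous fun r : ℝ => r ^ 2 * densityProfile r :=
    (continuous_pow 2).mul continuous_densityProfile
  have hI := intervalIntegral.integral_eq_sub_of_hasDerivAt hd (hc.intervalIntegrable _ _)
  have hv : (2 : ℝ) ^ 3 * profile (2 ^ 2) = 1 := by
    rw [profile_of_two_le (by norm_num), ← Real.rpow_natCast 2 2, ← Real.rpow_mul (by norm_num)]
    norm_num
  rw [hv] at hI
  have hz : ∀ r ∈ Set.Ioi (0 : ℝ), r ∉ Set.Ioc (0 : ℝ) 2 → r ^ 2 * densityProfile r = 0 := by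
    intro r hr hr2
    have : 2 ≤ r := by
      by_contra hlt
      exact hr2 ⟨hr, (not_le.1 hlt).le⟩
    rw [densityProfile_of_two_le this, mul_zero]
  rw [setIntegral_eq_of_subset_of_forall_sdiff_eq_zero measurableSet_Ioi
    Set.Ioc_subset_Ioi_self (fun r hr => hz r hr.1 hr.2),
    ← intervalIntegral.integral_of_le (by norm_num), hI]
  simp

/-- The mollifier of width `t`, of total mass `4π`. -/
def density (t : ℝ) (z : E3) : ℝ := (t ^ 3)⁻¹ * densityProfile (‖z‖ / t)

lemma continuous_density (t : ℝ) : Continuous (density t) := by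
  have := continuous_densityProfile
  unfold density
  fun_prop

lemma density_of_le {t : ℝ} (ht : 0 < t) {z : E3} (hz : 2 * t ≤ ‖z‖) : density t z = 0 := by
  rw [density, densityProfile_of_two_le ((le_div_iff₀ ht).2 hz), mul_zero]

lemma exists_abs_density_le : ∃ D : ℝ, 0 < D ∧ ∀ t, 0 < t → ∀ z, |density t z| ≤ D * (t ^ 3)⁻¹ := by
  obtain ⟨D, hD, h⟩ := exists_abs_densityProfile_le
  refine ⟨D, hD, fun t ht z => ?_⟩
  rw [density, abs_mul, abs_of_pos (by positivity : 0 < (t ^ 3)⁻¹), mul_comm]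
  exact mul_le_mul_of_nonneg_right (h _ (by positivity)) (by positivity)

lemma integral_density {t : ℝ} (ht : 0 < t) : ∫ z, density t z = 4 * Real.pi := by
  have h1 : ∫ z : E3, densityProfile ‖z‖ = 4 * Real.pi := by
    rw [integral_fun_norm_addHaar]
    simp only [finrank_euclideanSpace, Fintype.card_fin, smul_eq_mul]
    norm_num
    rw [integral_sq_mul_densityProfile, Measure.real, EuclideanSpace.volume_ball_fin_three]
    rw [ENNReal.toReal_mul, ENNReal.toReal_ofReal (by positivity)]
    simp
    ring
  have h2 := Measure.integral_comp_inv_smul (volume : Measure E3)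
    (fun z => densityProfile ‖z‖) t
  simp only [density]
  rw [integral_const_mul]
  have h3 : ∀ z : E3, ‖z‖ / t = ‖t⁻¹ • z‖ := by
    intro z
    rw [norm_smul, norm_inv, Real.norm_of_nonneg ht.le]; ring
  simp only [h3, h2, h1, finrank_euclideanSpace, Fintype.card_fin, smul_eq_mul,
    abs_of_pos (pow_pos ht 3)]
  field_simp

/-- The radial factor of the kernel `z / |z|³` regularised at the scale `t`. -/
def kern (t : ℝ) (z : E3) : ℝ := (t ^ 3)⁻¹ * profile (‖z‖ ^ 2 / t ^ 2)

lemma rpow_scale {t : ℝ} (ht : 0 < t) (z : E3) :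
    (t ^ 3)⁻¹ * (‖z‖ ^ 2 / t ^ 2) ^ (-(3 / 2) : ℝ) = (‖z‖ ^ 3)⁻¹ := by
  -- At z = 0 both sides are 0, by the conventions for powers and inverses of 0.
  rcases (norm_nonneg z).eq_or_lt with h | h
  · rw [← h]
    have : ((0 : ℝ) ^ 2 / t ^ 2) = 0 := by simp
    rw [this, Real.zero_rpow (by norm_num)]; simp
  have e : ∀ r : ℝ, 0 < r → (r ^ 2) ^ (3 / 2 : ℝ) = r ^ 3 := by
    intro r hr
    rw [← Real.rpow_natCast r 2, ← Real.rpow_mul hr.le, ← Real.rpow_natCast r 3]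
    norm_num
  rw [Real.rpow_neg (by positivity), Real.div_rpow (by positivity) (by positivity), e _ h, e _ ht]
  field_simp

lemma kern_nonneg {t : ℝ} (ht : 0 < t) (z : E3) : 0 ≤ kern t z :=
  mul_nonneg (by positivity) (profile_nonneg _)

lemma kern_le {t : ℝ} (ht : 0 < t) (z : E3) : kern t z ≤ (‖z‖ ^ 3)⁻¹ := by
  rw [← rpow_scale ht]
  exact mul_le_mul_of_nonneg_left (profile_le (by positivity)) (by positivity)

lemma kern_of_le {t : ℝ} (ht : 0 < t) {z : E3} (hz : ‖z‖ ≤ t) : kern t z = 0 := by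
  rw [kern, profile_of_le_one, mul_zero]
  rw [div_le_one (by positivity)]
  exact pow_le_pow_left₀ (norm_nonneg _) hz 2

lemma kern_of_two_mul_le {t : ℝ} (ht : 0 < t) {z : E3} (hz : 2 * t ≤ ‖z‖) :
    kern t z = (‖z‖ ^ 3)⁻¹ := by
  rw [← rpow_scale ht, kern, profile_of_two_le]
  rw [le_div_iff₀ (by positivity)]
  nlinarith

lemma contDiff_kern (t : ℝ) : ContDiff ℝ ((⊤ : ℕ∞) : WithTop ℕ∞) (kern t) :=
  contDiff_const.mul (contDiff_profile.comp ((contDiff_norm_sq ℝ).div_const _))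

lemma hasFDerivAt_kern (t : ℝ) (z : E3) :
    HasFDerivAt (kern t)
      (((t ^ 3)⁻¹ * deriv profile (‖z‖ ^ 2 / t ^ 2) * (t ^ 2)⁻¹ * 2) • innerSL ℝ z) z := by
  have h1 : HasFDerivAt (fun z : E3 => ‖z‖ ^ 2) (2 • innerSL ℝ z) z :=
    (hasStrictFDerivAt_norm_sq z).hasFDerivAt
  have h2 := ((hasDerivAt_profile (‖z‖ ^ 2 / t ^ 2)).comp_hasFDerivAt z
    (h1.mul_const (t ^ 2)⁻¹)).const_mul (t ^ 3)⁻¹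
  refine h2.congr_fderiv ?_
  ext v
  simp
  ring

/-- Partial derivatives of the field `z ↦ kern t z • z`. -/
def kernGrad (t : ℝ) (m j : Fin 3) (z : E3) : ℝ :=
  (if m = j then kern t z else 0) +
    2 * (t ^ 5)⁻¹ * deriv profile (‖z‖ ^ 2 / t ^ 2) * z m * z j

/-- A radial function times z is a gradient field; this symmetry is what the anticommutation
argument requires. -/
lemma kernGrad_symm (t : ℝ) (m j : Fin 3) (z : E3) : kernGrad t m j z = kernGrad t j m z := by
  unfold kernGrad
  simp only [eq_comm (a := m)]
  ring

lemma sum_kernGrad {t : ℝ} (ht : 0 < t) (z : E3) : ∑ j, kernGrad t j j z = density t z := by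
  simp only [kernGrad, if_true, Finset.sum_add_distrib]
  have h : ∑ j, 2 * (t ^ 5)⁻¹ * deriv profile (‖z‖ ^ 2 / t ^ 2) * z j * z j =
      2 * (t ^ 5)⁻¹ * deriv profile (‖z‖ ^ 2 / t ^ 2) * ‖z‖ ^ 2 := by
    rw [EuclideanSpace.norm_sq_eq, Finset.mul_sum]
    refine Finset.sum_congr rfl fun j _ => ?_
    rw [Real.norm_eq_abs, sq_abs]; ring
  rw [h, density, densityProfile, kern, div_pow]
  simp
  field_simp

lemma hasFDerivAt_kern_mul (t : ℝ) (m : Fin 3) (z : E3) :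
    ∃ L : E3 →L[ℝ] ℝ, HasFDerivAt (fun z : E3 => kern t z * z m) L z ∧
      ∀ j, L (EuclideanSpace.single j 1) = kernGrad t m j z := by
  have h1 : HasFDerivAt (fun z : E3 => z m) (EuclideanSpace.proj m : E3 →L[ℝ] ℝ) z :=
    (EuclideanSpace.proj m : E3 →L[ℝ] ℝ).hasFDerivAt
  refine ⟨_, (hasFDerivAt_kern t z).mul h1, fun j => ?_⟩
  have h2 : (EuclideanSpace.proj m : E3 →L[ℝ] ℝ) (EuclideanSpace.single j 1) =
      if m = j then 1 else 0 := by simp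
  rw [add_apply, smul_apply, smul_apply, smul_apply, h2, kernGrad, innerSL_apply_apply,
    EuclideanSpace.inner_single_right]
  rcases eq_or_ne m j with h | h
  · simp [h]; ring
  · simp [h]; ring

/-- The difference of two regularisations of `z / |z|³`, reflected about `x`. -/
def testField (t R : ℝ) (x y : E3) : E3 := (kern t (x - y) - kern R (x - y)) • (x - y)

lemma contDiff_testField (t R : ℝ) (x : E3) :
    ContDiff ℝ ((⊤ : ℕ∞) : WithTop ℕ∞) (testField t R x) := by
  have h : ContDiff ℝ ((⊤ : ℕ∞) : WithTop ℕ∞) fun y : E3 => x - y := contDiff_const.sub contDiff_id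
  exact (((contDiff_kern t).comp h).sub ((contDiff_kern R).comp h)).smul h

/-- A single truncation decays only like |z|⁻², but both agree with z/|z|³ far out, so they cancel
there. This is why a difference is used. -/
lemma hasCompactSupport_testField {t R : ℝ} (ht : 0 < t) (hR : 0 < R) (x : E3) :
    HasCompactSupport (testField t R x) := by
  refine HasCompactSupport.intro (isCompact_closedBall x (2 * t + 2 * R)) fun y hy => ?_
  have hy' : 2 * t + 2 * R < ‖x - y‖ := by
    rw [mem_closedBall, not_le, dist_comm, dist_eq_norm] at hy; exact hy
  rw [testField, kern_of_two_mul_le ht (by linarith), kern_of_two_mul_le hR (by linarith)]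
  simp

lemma fderiv_testField (t R : ℝ) (x : E3) (m j : Fin 3) (y : E3) :
    fderiv ℝ (fun y => testField t R x y m) y (EuclideanSpace.single j 1) =
      -(kernGrad t m j (x - y) - kernGrad R m j (x - y)) := by
  obtain ⟨L, hL, hLj⟩ := hasFDerivAt_kern_mul t m (x - y)
  obtain ⟨L', hL', hLj'⟩ := hasFDerivAt_kern_mul R m (x - y)
  have h0 : HasFDerivAt (fun y : E3 => x - y) (-ContinuousLinearMap.id ℝ E3) y :=
    (hasFDerivAt_id y).const_sub x
  have h := (hL.sub hL').comp y h0
  have e : (fun y => testField t R x y m) =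
      ((fun z : E3 => kern t z * z m) - (fun z : E3 => kern R z * z m)) ∘ (fun y : E3 => x - y) := by
    ext y
    simp [testField, sub_mul]
  rw [e, h.fderiv]
  simp [hLj, hLj']

/-- The regularised representation formula. The reflection y ↦ x - y reverses the sign of the
divergence, whence -i in place of i. -/
lemma integral_density_smul_eq {f h : E3 → Fin 4 → ℂ} {Df : Fin 3 → E3 → Fin 4 → ℂ}
    (hD : ∀ j k, HasWeakPartialDeriv j (fun x => f x k) (fun x => Df j x k))
    (heq : ∀ᵐ x, 0 = (∑ j : Fin 3, alpha j *ᵥ ((1 / Complex.I) • Df j x)) + h x)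
    {t R : ℝ} (ht : 0 < t) (hR : 0 < R) (x : E3) :
    ∫ y, (density t (x - y) - density R (x - y)) • f y =
      (-Complex.I) • ∫ y, alphaDot (testField t R x y) *ᵥ h y := by
  have := integral_div_smul_eq hD heq (testField t R x) (contDiff_testField t R x)
    (hasCompactSupport_testField ht hR x) _ (fderiv_testField t R x)
    (fun m j y => by rw [kernGrad_symm t, kernGrad_symm R])
  simp only [Finset.sum_neg_distrib, Finset.sum_sub_distrib, sum_kernGrad ht, sum_kernGrad hR]
    at this
  rw [neg_smul, ← this, ← integral_neg]
  refine integral_congr_ae (ae_of_all _ fun y => ?_)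
  ext k
  simp
  ring

/-! ### Mollification at small and at large scales -/

lemma measureReal_closedBall (x : E3) {r : ℝ} (hr : 0 ≤ r) :
    (volume : Measure E3).real (closedBall x r) = r ^ 3 * (Real.pi * 4 / 3) := by
  rw [Measure.real, EuclideanSpace.volume_closedBall_fin_three, ENNReal.toReal_mul,
    ENNReal.toReal_ofReal (by positivity), ENNReal.toReal_pow, ENNReal.toReal_ofReal hr]

lemma hasCompactSupport_density_sub {t : ℝ} (ht : 0 < t) (x : E3) :
    HasCompactSupport fun y => density t (x - y) := by
  refine HasCompactSupport.intro (isCompact_closedBall x (2 * t)) fun y hy => ?_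
  refine density_of_le ht ?_
  rw [mem_closedBall, not_le, dist_comm, dist_eq_norm] at hy
  exact hy.le

lemma continuous_density_sub (t : ℝ) (x : E3) : Continuous fun y => density t (x - y) :=
  (continuous_density t).comp (continuous_const.sub continuous_id)

lemma integrable_density_smul {f : E3 → Fin 4 → ℂ} (hf : LocallyIntegrable f) {t : ℝ}
    (ht : 0 < t) (x : E3) : Integrable fun y => density t (x - y) • f y :=
  hf.integrable_smul_left_of_hasCompactSupport (continuous_density_sub t x)
    (hasCompactSupport_density_sub ht x)

lemma norm_density_smul_le {D : ℝ}
    (hD : ∀ t, 0 < t → ∀ z, |density t z| ≤ D * (t ^ 3)⁻¹) {t : ℝ} (ht : 0 < t)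
    (x : E3) {g : E3 → Fin 4 → ℂ} (hg : LocallyIntegrable g) :
    ‖∫ y, density t (x - y) • g y‖ ≤ D * (t ^ 3)⁻¹ * ∫ y in closedBall x (2 * t), ‖g y‖ := by
  have h1 : ∫ y, density t (x - y) • g y =
      ∫ y in closedBall x (2 * t), density t (x - y) • g y := by
    refine (setIntegral_eq_integral_of_forall_compl_eq_zero fun y hy => ?_).symm
    rw [density_of_le ht, zero_smul]
    rw [mem_closedBall, not_le, dist_comm, dist_eq_norm] at hy
    exact hy.le
  rw [h1, ← integral_const_mul]
  refine norm_integral_le_of_norm_le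
    ((hg.integrableOn_isCompact (isCompact_closedBall _ _)).norm.const_mul _)
    (ae_of_all _ fun y => ?_)
  rw [norm_smul]
  exact mul_le_mul_of_nonneg_right (hD t ht _) (norm_nonneg _)

/-- Mollification converges at every Lebesgue point. -/
lemma ae_tendsto_integral_density_smul {f : E3 → Fin 4 → ℂ} (hf : LocallyIntegrable f) :
    ∀ᵐ x, Tendsto (fun t : ℝ => ∫ y, density t (x - y) • f y) (𝓝[>] 0)
      (𝓝 ((4 * Real.pi) • f x)) := by
  obtain ⟨D, hD0, hD⟩ := exists_abs_density_le
  filter_upwards [IsUnifLocDoublingMeasure.ae_tendsto_average_norm_sub volume hf 1] with x hx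
  have h2t : Tendsto (fun t : ℝ => 2 * t) (𝓝[>] 0) (𝓝[>] 0) := by
    refine tendsto_nhdsWithin_iff.2 ⟨?_, ?_⟩
    · have : Tendsto (fun t : ℝ => 2 * t) (𝓝 0) (𝓝 (2 * 0)) := tendsto_id.const_mul 2
      rw [mul_zero] at this
      exact this.mono_left nhdsWithin_le_nhds
    · filter_upwards [self_mem_nhdsWithin] with t ht
      have ht : (0 : ℝ) < t := ht
      exact mul_pos two_pos ht
  have hlim := hx (fun _ : ℝ => x) (fun t => 2 * t) h2t (by
    filter_upwards [self_mem_nhdsWithin] with t ht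
    have ht : (0 : ℝ) < t := ht
    simp [ht.le])
  have hlim2 := hlim.const_mul (D * (8 * (Real.pi * 4 / 3)))
  rw [mul_zero] at hlim2
  rw [tendsto_iff_norm_sub_tendsto_zero]
  refine squeeze_zero' (Eventually.of_forall fun _ => norm_nonneg _) ?_ hlim2
  filter_upwards [self_mem_nhdsWithin] with t ht
  have ht : (0 : ℝ) < t := ht
  have hcl : LocallyIntegrable fun _ : E3 => f x := locallyIntegrable_const _
  -- The mass 4π is independent of `t`, so the limit value is itself a mollification of the constant
  -- f(x).
  have e : (4 * Real.pi) • f x = ∫ y, density t (x - y) • f x := by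
    rw [integral_smul_const, integral_sub_left_eq_self (density t), integral_density ht]
  rw [e, ← integral_sub (integrable_density_smul hf ht x) (integrable_density_smul hcl ht x)]
  simp only [← smul_sub]
  refine (norm_density_smul_le hD ht x (hf.sub hcl)).trans (le_of_eq ?_)
  rw [setAverage_eq, measureReal_closedBall x (by positivity), smul_eq_mul]
  simp only [Pi.sub_apply]
  field_simp
  ring

/-- Mollification at large scale tends to zero for square integrable functions. -/
lemma tendsto_integral_density_smul_atTop {f : E3 → Fin 4 → ℂ} (hf : LocallyIntegrable f)
    (hf2 : Integrable fun y => ‖f y‖ ^ 2) (x : E3) :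
    Tendsto (fun R : ℝ => ∫ y, density R (x - y) • f y) atTop (𝓝 0) := by
  obtain ⟨D, hD0, hD⟩ := exists_abs_density_le
  rw [tendsto_zero_iff_norm_tendsto_zero]
  have hlim : Tendsto (fun R : ℝ => D * (∫ y, ‖f y‖ ^ 2) * (R ^ 2)⁻¹ +
      D * 8 * (Real.pi * 4 / 3) * R⁻¹) atTop (𝓝 0) := by
    have h1 : Tendsto (fun R : ℝ => (R ^ 2)⁻¹) atTop (𝓝 0) :=
      tendsto_inv_atTop_zero.comp (tendsto_pow_atTop (by norm_num))
    have := (h1.const_mul (D * (∫ y, ‖f y‖ ^ 2))).add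
      (tendsto_inv_atTop_zero.const_mul (D * 8 * (Real.pi * 4 / 3)))
    simpa using this
  refine squeeze_zero' (Eventually.of_forall fun _ => norm_nonneg _) ?_ hlim
  filter_upwards [eventually_gt_atTop 0] with R hR
  refine (norm_density_smul_le hD hR x hf).trans ?_
  -- From ‖f‖ ≤ R‖f‖² + R⁻¹: the integral is O(R) + O(R²), which the factor R⁻³ of the mollifier
  -- beats.
  have hI : ∫ y in closedBall x (2 * R), ‖f y‖ ≤
      R * (∫ y, ‖f y‖ ^ 2) + (2 * R) ^ 3 * (Real.pi * 4 / 3) * R⁻¹ := by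
    calc ∫ y in closedBall x (2 * R), ‖f y‖
        ≤ ∫ y in closedBall x (2 * R), (R * ‖f y‖ ^ 2 + R⁻¹) := by
          refine integral_mono
            (hf.integrableOn_isCompact (isCompact_closedBall _ _)).norm
            ((hf2.const_mul R).integrableOn.add (integrableOn_const measure_closedBall_lt_top.ne)) fun y => ?_
          change ‖f y‖ ≤ R * ‖f y‖ ^ 2 + R⁻¹
          have h1 : R * R⁻¹ = 1 := mul_inv_cancel₀ hR.ne'
          have h2 : 0 < R⁻¹ := inv_pos.2 hR
          have h3 : 0 ≤ R * (‖f y‖ - R⁻¹) ^ 2 := by positivity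
          nlinarith [norm_nonneg (f y)]
      _ = R * (∫ y in closedBall x (2 * R), ‖f y‖ ^ 2) +
          (2 * R) ^ 3 * (Real.pi * 4 / 3) * R⁻¹ := by
          rw [integral_add (hf2.const_mul R).integrableOn (integrableOn_const measure_closedBall_lt_top.ne),
            integral_const_mul, setIntegral_const, measureReal_closedBall x (by positivity),
            smul_eq_mul]
      _ ≤ _ := by
          gcongr
          · exact ae_of_all _ fun y => by positivity
          · exact Measure.restrict_le_self
  calc D * (R ^ 3)⁻¹ * ∫ y in closedBall x (2 * R), ‖f y‖
      ≤ D * (R ^ 3)⁻¹ * (R * (∫ y, ‖f y‖ ^ 2) + (2 * R) ^ 3 * (Real.pi * 4 / 3) * R⁻¹) := by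
        gcongr
    _ = _ := by field_simp; ring

/-! ### Representation of a solution by its potential -/

/-- The field `z / |z|³`. -/
def newton (z : E3) : E3 := (‖z‖ ^ 3)⁻¹ • z

lemma enorm_newton_le (z : E3) : ‖newton z‖ₑ ≤ riesz 2 z := by
  by_cases hz : z = 0
  · simp [hz, newton]
  have h0 : 0 < ‖z‖ := norm_pos_iff.2 hz
  rw [riesz_eq_ofReal 2 hz, ← ofReal_norm, newton, norm_smul,
    Real.norm_of_nonneg (by positivity)]
  refine ENNReal.ofReal_le_ofReal (le_of_eq ?_)
  rw [Real.rpow_neg h0.le]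
  norm_cast
  field_simp

lemma enorm_smul_le_of_abs_le {c : ℝ} {z : E3} (hc : |c| ≤ (‖z‖ ^ 3)⁻¹) :
    ‖c • z‖ₑ ≤ riesz 2 z := by
  refine le_trans ?_ (enorm_newton_le z)
  rw [enorm_le_iff_norm_le, newton, norm_smul, norm_smul, Real.norm_eq_abs,
    Real.norm_of_nonneg (show 0 ≤ (‖z‖ ^ 3)⁻¹ by positivity)]
  exact mul_le_mul_of_nonneg_right hc (norm_nonneg _)

lemma enorm_testField_le {t R : ℝ} (ht : 0 < t) (hR : 0 < R) (x y : E3) :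
    ‖testField t R x y‖ₑ ≤ riesz 2 (x - y) :=
  enorm_smul_le_of_abs_le (abs_sub_le_of_nonneg_of_le (kern_nonneg ht _) (kern_le ht _)
    (kern_nonneg hR _) (kern_le hR _))

lemma enorm_alphaDot_mulVec_le (v : E3) (u : Fin 4 → ℂ) :
    ‖alphaDot v *ᵥ u‖ₑ ≤ 12 * (‖v‖ₑ * ‖u‖ₑ) := by
  rw [← ofReal_norm, ← ofReal_norm, ← ofReal_norm, ← ENNReal.ofReal_mul (norm_nonneg _),
    ← ENNReal.ofReal_ofNat 12, ← ENNReal.ofReal_mul (by norm_num), ← mul_assoc]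
  exact ENNReal.ofReal_le_ofReal (norm_alphaDot_mulVec_le v u)

/-- The family is eventually constant: once 2t < |x-y| < 1/t the inner truncation is exact and the
outer one vanishes. Taking R = 1/t merges the two limits. -/
lemma tendsto_testField (x y : E3) :
    Tendsto (fun t : ℝ => testField t t⁻¹ x y) (𝓝[>] 0) (𝓝 (newton (x - y))) := by
  refine tendsto_const_nhds.congr' ?_
  by_cases hz : x - y = 0
  · exact Eventually.of_forall fun t => by simp [testField, newton, hz]
  have h0 : 0 < ‖x - y‖ := norm_pos_iff.2 hz
  have hm : Set.Ioo (0 : ℝ) (min (‖x - y‖ / 2) ‖x - y‖⁻¹) ∈ 𝓝[>] (0 : ℝ) :=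
    Ioo_mem_nhdsGT (by positivity)
  filter_upwards [hm] with t ht
  have h1 := (lt_min_iff.1 ht.2).1
  have h2 := (lt_min_iff.1 ht.2).2
  rw [testField, kern_of_two_mul_le ht.1 (by linarith),
    kern_of_le (inv_pos.2 ht.1) ((le_inv_comm₀ h0 ht.1).2 h2.le), sub_zero, newton]

lemma measurable_newton : Measurable newton := by
  unfold newton; fun_prop

lemma aestronglyMeasurable_alphaDot_mulVec {Φ : E3 → E3} (hΦ : Measurable Φ)
    {h : E3 → Fin 4 → ℂ} (hh : AEStronglyMeasurable h volume) :
    AEStronglyMeasurable (fun y => alphaDot (Φ y) *ᵥ h y) volume := by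
  simp only [alphaDot, Matrix.sum_mulVec, Matrix.smul_mulVec]
  refine Finset.aestronglyMeasurable_fun_sum _ fun j _ => ?_
  have h1 : AEStronglyMeasurable (fun y => alpha j *ᵥ h y) volume :=
    (LinearMap.toContinuousLinearMap (alpha j).mulVecLin).continuous.comp_aestronglyMeasurable hh
  have h2 : Measurable fun y => ((Φ y j : ℝ) : ℂ) :=
    Complex.measurable_ofReal.comp
      ((EuclideanSpace.proj j : E3 →L[ℝ] ℝ).continuous.measurable.comp hΦ)
  exact h2.aestronglyMeasurable.smul h1

lemma ae_tendsto_integral_testField {f h : E3 → Fin 4 → ℂ} {Df : Fin 3 → E3 → Fin 4 → ℂ}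
    (hD : ∀ j k, HasWeakPartialDeriv j (fun x => f x k) (fun x => Df j x k))
    (heq : ∀ᵐ x, 0 = (∑ j : Fin 3, alpha j *ᵥ ((1 / Complex.I) • Df j x)) + h x)
    (hf : LocallyIntegrable f) (hf2 : Integrable fun y => ‖f y‖ ^ 2) :
    ∀ᵐ x, Tendsto (fun t : ℝ => (-Complex.I) • ∫ y, alphaDot (testField t t⁻¹ x y) *ᵥ h y)
      (𝓝[>] 0) (𝓝 ((4 * Real.pi) • f x)) := by
  filter_upwards [ae_tendsto_integral_density_smul hf] with x hx
  have h2 := hx.sub ((tendsto_integral_density_smul_atTop hf hf2 x).comp tendsto_inv_nhdsGT_zero)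
  rw [sub_zero] at h2
  refine h2.congr' ?_
  filter_upwards [self_mem_nhdsWithin] with t ht
  have ht : (0 : ℝ) < t := ht
  rw [← integral_density_smul_eq hD heq ht (inv_pos.2 ht), Function.comp,
    ← integral_sub (integrable_density_smul hf ht x)
      (integrable_density_smul hf (inv_pos.2 ht) x)]
  simp only [sub_smul]

/-- The a priori bound `|f| ≤ C |·|⁻² * |h|`. -/
lemma ae_enorm_le_lintegral {f h : E3 → Fin 4 → ℂ} {Df : Fin 3 → E3 → Fin 4 → ℂ}
    (hD : ∀ j k, HasWeakPartialDeriv j (fun x => f x k) (fun x => Df j x k))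
    (heq : ∀ᵐ x, 0 = (∑ j : Fin 3, alpha j *ᵥ ((1 / Complex.I) • Df j x)) + h x)
    (hf : LocallyIntegrable f) (hf2 : Integrable fun y => ‖f y‖ ^ 2) :
    ∀ᵐ x, ‖f x‖ₑ ≤ 12 * ∫⁻ y, riesz 2 (x - y) * ‖h y‖ₑ := by
  filter_upwards [ae_tendsto_integral_testField hD heq hf hf2] with x hx
  have h1 : ‖(4 * Real.pi) • f x‖ₑ ≤ 12 * ∫⁻ y, riesz 2 (x - y) * ‖h y‖ₑ := by
    -- The bound holds for every `t` and passes to the limit, so the right side may still be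
    -- infinite.
    refine le_of_tendsto hx.enorm ?_
    filter_upwards [self_mem_nhdsWithin] with t ht
    have ht : (0 : ℝ) < t := ht
    rw [enorm_smul, enorm_neg, ← lintegral_const_mul' _ _ (by simp)]
    have : ‖Complex.I‖ₑ = 1 := by rw [← ofReal_norm]; simp
    rw [this, one_mul]
    refine (enorm_integral_le_lintegral_enorm _).trans (lintegral_mono fun y => ?_)
    refine (enorm_alphaDot_mulVec_le _ _).trans ?_
    gcongr
    exact enorm_testField_le ht (inv_pos.2 ht) x y
  refine le_trans ?_ h1
  rw [enorm_le_iff_norm_le, norm_smul, Real.norm_of_nonneg (by positivity)]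
  have := Real.pi_gt_three
  nlinarith [norm_nonneg (f x)]

lemma norm_le_toReal {F : Fin 4 → ℂ} {X : ℝ≥0∞} (h : ‖F‖ₑ ≤ X) (hX : X ≠ ∞) :
    ‖F‖ ≤ X.toReal := by
  rw [← toReal_enorm]; exact ENNReal.toReal_mono hX h

lemma aemeasurable_riesz_mul {h : E3 → Fin 4 → ℂ} (hh : AEStronglyMeasurable h) (p : ℝ) (x : E3) :
    AEMeasurable fun y => riesz p (x - y) * ‖h y‖ₑ :=
  ((measurable_riesz p).comp (measurable_const_sub x)).aemeasurable.mul hh.enorm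

/-- The potential `-(i/4π) ∫ (α · (x - y)) |x - y|⁻³ h(y) dy`. -/
def potential (h : E3 → Fin 4 → ℂ) (x : E3) : Fin 4 → ℂ :=
  (-(Complex.I / (4 * (Real.pi : ℂ)))) • ∫ y, alphaDot (newton (x - y)) *ᵥ h y

lemma integrable_of_enorm_le {F : E3 → Fin 4 → ℂ} (hF : AEStronglyMeasurable F)
    {X : E3 → ℝ≥0∞} (hle : ∀ᵐ y, ‖F y‖ₑ ≤ X y) (hX : ∫⁻ y, X y ≠ ∞) : Integrable F :=
  ⟨hF, lt_of_le_of_lt (lintegral_mono_ae hle) hX.lt_top⟩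

/-- A solution of `(α · D) f = -h` is the potential of `h`. -/
lemma ae_eq_potential {f h : E3 → Fin 4 → ℂ} {Df : Fin 3 → E3 → Fin 4 → ℂ}
    (hD : ∀ j k, HasWeakPartialDeriv j (fun x => f x k) (fun x => Df j x k))
    (heq : ∀ᵐ x, 0 = (∑ j : Fin 3, alpha j *ᵥ ((1 / Complex.I) • Df j x)) + h x)
    (hf : LocallyIntegrable f) (hf2 : Integrable fun y => ‖f y‖ ^ 2)
    (hh : AEStronglyMeasurable h)
    (hfin : ∀ x, ∫⁻ y, riesz 2 (x - y) * ‖h y‖ₑ ≠ ∞) :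
    potential h =ᵐ[volume] f := by
  filter_upwards [ae_tendsto_integral_testField hD heq hf hf2] with x hx
  have hm := (aemeasurable_riesz_mul hh 2 x).const_mul 12
  have hfin' : ∫⁻ y, 12 * (riesz 2 (x - y) * ‖h y‖ₑ) ≠ ∞ := by
    rw [lintegral_const_mul' _ _ (by simp)]
    exact ENNReal.mul_ne_top (by simp) (hfin x)
  have hlim : Tendsto (fun t : ℝ => ∫ y, alphaDot (testField t t⁻¹ x y) *ᵥ h y) (𝓝[>] 0)
      (𝓝 (∫ y, alphaDot (newton (x - y)) *ᵥ h y)) := by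
    refine tendsto_integral_filter_of_dominated_convergence
      (fun y => (12 * (riesz 2 (x - y) * ‖h y‖ₑ)).toReal) ?_ ?_
      (integrable_toReal_of_lintegral_ne_top hm hfin') (ae_of_all _ fun y => ?_)
    · exact Eventually.of_forall fun t => aestronglyMeasurable_alphaDot_mulVec
        (contDiff_testField t t⁻¹ x).continuous.measurable hh
    · filter_upwards [self_mem_nhdsWithin] with t ht
      have ht : (0 : ℝ) < t := ht
      filter_upwards [ae_lt_top' hm hfin'] with y hy
      refine norm_le_toReal ((enorm_alphaDot_mulVec_le _ _).trans ?_) hy.ne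
      gcongr
      exact enorm_testField_le ht (inv_pos.2 ht) x y
    · have hc : Continuous fun v : E3 => alphaDot v *ᵥ h y :=
        continuous_alphaDot.matrix_mulVec continuous_const
      exact (hc.tendsto _).comp (tendsto_testField x y)
  have he := tendsto_nhds_unique hx (hlim.const_smul (-Complex.I))
  have hpi : (Real.pi : ℂ) ≠ 0 := by exact_mod_cast Real.pi_ne_zero
  have he2 : (4 * (Real.pi : ℂ)) • f x = (4 * Real.pi) • f x := by
    ext k; simp
  have he3 : f x = (4 * (Real.pi : ℂ))⁻¹ • ((4 * (Real.pi : ℂ)) • f x) := by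
    rw [smul_smul, inv_mul_cancel₀ (by simp [hpi]), one_smul]
  rw [he3, he2, he, potential, smul_smul]
  congr 1
  ring

/-! ### Boundedness and the decay bootstrap -/

/-- The weight `⟨y⟩⁻^ρ`, with values in `[0, ∞]`. -/
def weight (ρ : ℝ) (y : E3) : ℝ≥0∞ := ENNReal.ofReal (bracket y ^ (-ρ))

lemma measurable_weight (ρ : ℝ) : Measurable (weight ρ) := by
  unfold weight bracket; fun_prop

lemma one_le_bracket (y : E3) : 1 ≤ bracket y := by
  rw [bracket, Real.one_le_sqrt]
  linarith [sq_nonneg ‖y‖]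

lemma norm_le_bracket (y : E3) : ‖y‖ ≤ bracket y :=
  Real.le_sqrt_of_sq_le (by linarith)

lemma weight_le_riesz {ρ s : ℝ} (hs : 0 ≤ s) (hsρ : s ≤ ρ) (y : E3) :
    weight ρ y ≤ riesz s y := by
  have hb := one_le_bracket y
  have hb0 : 0 < bracket y := by linarith
  have h1 : weight ρ y ≤ ENNReal.ofReal (bracket y) ^ (-s) := by
    rw [ENNReal.ofReal_rpow_of_pos hb0, weight]
    exact ENNReal.ofReal_le_ofReal (Real.rpow_le_rpow_of_exponent_le hb (by linarith))
  refine h1.trans ?_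
  rw [riesz, ENNReal.rpow_neg, ENNReal.rpow_neg, ← ofReal_norm]
  exact ENNReal.inv_le_inv.2
    (ENNReal.rpow_le_rpow (ENNReal.ofReal_le_ofReal (norm_le_bracket y)) hs)

lemma weight_le_one {ρ : ℝ} (hρ : 0 ≤ ρ) (y : E3) : weight ρ y ≤ 1 := by
  simpa [riesz] using weight_le_riesz (s := 0) le_rfl hρ y

lemma riesz_one_sq (z : E3) : riesz 1 z ^ 2 = riesz 2 z := by
  rw [riesz, riesz, ← ENNReal.rpow_natCast, ← ENNReal.rpow_mul]
  norm_num

lemma mul_le_sq_add_sq (a b : ℝ≥0∞) : a * b ≤ a ^ 2 + b ^ 2 := by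
  rcases le_total a b with h | h
  · exact (mul_le_mul_left h b).trans (by rw [← sq]; exact le_add_self)
  · exact (mul_le_mul_right h a).trans (by rw [← sq]; exact le_self_add)

/-- A square integrable function dominated by its own weighted Riesz potential has a bounded
weighted Riesz potential. -/
lemma exists_lintegral_riesz_weight_le {ρ : ℝ} (hρ : 1 < ρ) {u : E3 → ℝ≥0∞}
    (hum : AEMeasurable u) (hu2 : ∫⁻ y, u y ^ 2 ≠ ∞) {A : ℝ≥0∞} (hA : A ≠ ∞)
    (hu : ∀ᵐ x, u x ≤ A * ∫⁻ y, riesz 2 (x - y) * (weight ρ y * u y)) :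
    ∃ M : ℝ≥0∞, M ≠ ∞ ∧ ∀ x, ∫⁻ y, riesz 2 (x - y) * (weight ρ y * u y) ≤ M := by
  obtain ⟨C, hC, hCle⟩ := exists_lintegral_riesz_two_mul_riesz_two_le
  obtain ⟨C', hC', hCle'⟩ := exists_lintegral_riesz_mul_min_le
  refine ⟨A * (C * (C' + ∫⁻ y, u y ^ 2)), ?_, fun x => ?_⟩
  · exact ENNReal.mul_ne_top hA (ENNReal.mul_ne_top hC (ENNReal.add_ne_top.2 ⟨hC', hu2⟩))
  have hwu : AEMeasurable fun y => weight ρ y * u y := (measurable_weight ρ).aemeasurable.mul hum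
  have hm : AEMeasurable (Function.uncurry fun z y : E3 =>
      riesz 2 (x - z) * riesz 2 (z - y) * (weight ρ y * u y)) (volume.prod volume) := by
    refine AEMeasurable.mul ?_ hwu.comp_snd
    have h1 := measurable_riesz 2
    exact ((h1.comp (measurable_fst.const_sub x)).mul
      (h1.comp (measurable_fst.sub measurable_snd))).aemeasurable
  have inner : ∀ y, y ≠ x → ∫⁻ z, riesz 2 (x - z) * riesz 2 (z - y) ≤ C * riesz 1 (x - y) := by
    intro y hy
    rw [← lintegral_add_right_eq_self _ y]
    refine le_trans (le_of_eq ?_) (hCle (x - y) (sub_ne_zero.2 hy.symm))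
    congr 1; ext z
    rw [add_sub_cancel_right]; congr 2; abel
  -- |·|⁻² is not locally square integrable on ℝ³, so pairing it with u ∈ L² fails. Inserting the
  -- hypothesis once and applying Tonelli replaces it by |·|⁻² * |·|⁻² ≤ C|·|⁻¹, which is locally
  -- square integrable.
  calc ∫⁻ z, riesz 2 (x - z) * (weight ρ z * u z)
      ≤ ∫⁻ z, A * ∫⁻ y, riesz 2 (x - z) * riesz 2 (z - y) * (weight ρ y * u y) := by
        refine lintegral_mono_ae ?_
        have hne : ∀ᵐ z : E3, z ≠ x := by simp [ae_iff]
        filter_upwards [hu, hne] with z hz hzx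
        have hfin : riesz 2 (x - z) ≠ ∞ := by
          rw [riesz_eq_ofReal _ (sub_ne_zero.2 hzx.symm)]; exact ENNReal.ofReal_ne_top
        simp only [mul_assoc]
        rw [lintegral_const_mul' _ _ hfin, mul_left_comm A]
        refine mul_le_mul_right ?_ _
        exact (mul_le_of_le_one_left' (weight_le_one (by linarith) z)).trans hz
    _ = A * ∫⁻ z, ∫⁻ y, riesz 2 (x - z) * riesz 2 (z - y) * (weight ρ y * u y) :=
        lintegral_const_mul' _ _ hA
    _ = A * ∫⁻ y, ∫⁻ z, riesz 2 (x - z) * riesz 2 (z - y) * (weight ρ y * u y) := by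
        rw [lintegral_lintegral_swap hm]
    _ ≤ A * ∫⁻ y, C * (riesz 2 (x - y) * min 1 (riesz 2 y) + u y ^ 2) := by
        gcongr A * ?_
        refine lintegral_mono_ae ?_
        have hne : ∀ᵐ z : E3, z ≠ x := by simp [ae_iff]
        filter_upwards [hne] with y hy
        have h1 : Measurable fun z => riesz 2 (x - z) * riesz 2 (z - y) :=
          ((measurable_riesz 2).comp (measurable_const_sub x)).mul
            ((measurable_riesz 2).comp (measurable_id.sub_const y))
        rw [lintegral_mul_const _ h1]
        refine (mul_le_mul_left (inner y hy) _).trans ?_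
        rw [mul_assoc, ← mul_assoc (riesz 1 _)]
        gcongr C * ?_
        -- Separates u² from |x-y|⁻²⟨y⟩^(-2ρ); there ρ > 1 gives ⟨y⟩^(-2ρ) ≤ min(1, |y|⁻²).
        refine (mul_le_sq_add_sq _ _).trans ?_
        gcongr
        rw [mul_pow, riesz_one_sq]
        gcongr
        refine le_min (pow_le_one' (weight_le_one (by linarith) y) 2) ?_
        rw [← riesz_one_sq y]
        gcongr
        exact weight_le_riesz zero_le_one hρ.le y
    _ ≤ A * (C * (C' + ∫⁻ y, u y ^ 2)) := by
        rw [lintegral_const_mul' _ _ hC]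
        gcongr
        rw [lintegral_add_right' _ (hum.pow_const 2)]
        gcongr
        exact hCle' x

/-- One step of the decay bootstrap. -/
lemma exists_le_riesz_step {ρ : ℝ} {u : E3 → ℝ≥0∞} {A : ℝ≥0∞} (hA : A ≠ ∞)
    (hu : ∀ᵐ x, u x ≤ A * ∫⁻ y, riesz 2 (x - y) * (weight ρ y * u y))
    {a s : ℝ} (hs : 0 ≤ s) (hsρ : s ≤ ρ) (h1 : 1 < a + s) (h3 : a + s < 3)
    (ha : ∃ C : ℝ≥0∞, C ≠ ∞ ∧ ∀ᵐ x, u x ≤ C * riesz a x) :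
    ∃ C : ℝ≥0∞, C ≠ ∞ ∧ ∀ᵐ x, u x ≤ C * riesz (a + s - 1) x := by
  obtain ⟨C, hC, hle⟩ := ha
  obtain ⟨C', hC', hle'⟩ := exists_lintegral_riesz_mul_riesz_le (p := 2) (q := a + s)
    (by norm_num) (by norm_num) (by linarith) h3 (by linarith)
  refine ⟨A * (C * C'), ENNReal.mul_ne_top hA (ENNReal.mul_ne_top hC hC'), ?_⟩
  filter_upwards [hu, ae_ne_zero] with x hx hx0
  refine hx.trans ?_
  rw [mul_assoc, mul_assoc]
  gcongr
  calc ∫⁻ y, riesz 2 (x - y) * (weight ρ y * u y)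
      ≤ ∫⁻ y, C * (riesz 2 (x - y) * riesz (a + s) y) := by
        refine lintegral_mono_ae ?_
        filter_upwards [hle, ae_ne_zero] with y hy hy0
        rw [add_comm a s, ← riesz_mul_riesz s a hy0, mul_left_comm C, mul_left_comm C]
        exact mul_le_mul_right (mul_le_mul' (weight_le_riesz hs hsρ y) hy) _
    _ = C * ∫⁻ y, riesz 2 (x - y) * riesz (a + s) y := lintegral_const_mul' _ _ hC
    _ ≤ C * (C' * riesz (a + s - 1) x) := by
        gcongr
        refine (hle' x hx0).trans (le_of_eq ?_)
        congr 2; ring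

lemma exists_le_riesz {ρ : ℝ} (hρ : 1 < ρ) {u : E3 → ℝ≥0∞} {A : ℝ≥0∞} (hA : A ≠ ∞)
    (hu : ∀ᵐ x, u x ≤ A * ∫⁻ y, riesz 2 (x - y) * (weight ρ y * u y))
    (hM : ∃ M : ℝ≥0∞, M ≠ ∞ ∧ ∀ x, ∫⁻ y, riesz 2 (x - y) * (weight ρ y * u y) ≤ M)
    {a : ℝ} (ha : 0 < a) (ha2 : a < 2) :
    ∃ C : ℝ≥0∞, C ≠ ∞ ∧ ∀ᵐ x, u x ≤ C * riesz a x := by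
  obtain ⟨M, hM, hMle⟩ := hM
  -- The exponent `a` is reached from 0 in `n` equal steps, each shorter than the available gain ρ -
  -- 1.
  obtain ⟨n, hn⟩ := exists_nat_gt (a / (ρ - 1))
  have hn0 : (0 : ℝ) < n := lt_of_le_of_lt (div_nonneg ha.le (by linarith)) hn
  have hstep : a / n < ρ - 1 := by
    rw [div_lt_iff₀ (by linarith)] at hn
    rw [div_lt_iff₀ hn0]; linarith
  have hpos : 0 < a / n := div_pos ha hn0
  have key : ∀ k : ℕ, k ≤ n → ∃ C : ℝ≥0∞, C ≠ ∞ ∧ ∀ᵐ x, u x ≤ C * riesz (k * (a / n)) x := by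
    intro k
    induction k with
    | zero =>
      refine fun _ => ⟨A * M, ENNReal.mul_ne_top hA hM, ?_⟩
      filter_upwards [hu] with x hx
      simp only [Nat.cast_zero, zero_mul, riesz, neg_zero, ENNReal.rpow_zero, mul_one]
      exact hx.trans (mul_le_mul_right (hMle x) A)
    | succ k ih =>
      intro hk
      have hkn : ((k : ℝ) + 1) * (a / n) ≤ a := by
        have : (k : ℝ) + 1 ≤ n := by exact_mod_cast hk
        calc ((k : ℝ) + 1) * (a / n) ≤ n * (a / n) := by gcongr
          _ = a := by field_simp
      have hk0 : 0 ≤ (k : ℝ) * (a / n) := by positivity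
      -- Here s ≤ ρ by the choice of `n`, and k(a/n) + s ≤ 1 + a < 3 because a < 2.
      have := exists_le_riesz_step hA hu (s := 1 + a / n) (by linarith) (by linarith)
        (by linarith) (by linarith) (ih (by omega))
      convert this using 8
      push_cast; ring
  have := key n le_rfl
  rwa [mul_div_cancel₀ _ hn0.ne'] at this

/-- With δ = min(ρ-1, 1), decay of order 2 - δ/2 for `u` and ρ ≥ 1 + δ for the weight add up to at
least 3 + δ/2. The cap at 1 keeps the exponent positive when ρ is large. -/
lemma exists_weight_mul_le {ρ : ℝ} (hρ : 1 < ρ) {u : E3 → ℝ≥0∞} {A : ℝ≥0∞} (hA : A ≠ ∞)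
    (hu : ∀ᵐ x, u x ≤ A * ∫⁻ y, riesz 2 (x - y) * (weight ρ y * u y))
    (hM : ∃ M : ℝ≥0∞, M ≠ ∞ ∧ ∀ x, ∫⁻ y, riesz 2 (x - y) * (weight ρ y * u y) ≤ M) :
    ∃ b : ℝ, 3 < b ∧ ∃ B : ℝ≥0∞, B ≠ ∞ ∧ ∀ᵐ y, weight ρ y * u y ≤ B * min 1 (riesz b y) := by
  have hmin : 0 < min (ρ - 1) 1 := lt_min (by linarith) one_pos
  have hmin1 : min (ρ - 1) 1 ≤ 1 := min_le_right _ _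
  have hmin2 : min (ρ - 1) 1 ≤ ρ - 1 := min_le_left _ _
  obtain ⟨C, hC, hle⟩ := exists_le_riesz hρ hA hu hM (a := 2 - min (ρ - 1) 1 / 2)
    (by linarith) (by linarith)
  obtain ⟨M, hM, hMle⟩ := hM
  refine ⟨ρ + (2 - min (ρ - 1) 1 / 2), by linarith, C + A * M,
    ENNReal.add_ne_top.2 ⟨hC, ENNReal.mul_ne_top hA hM⟩, ?_⟩
  filter_upwards [hle, hu, ae_ne_zero] with y h1 h2 h0
  rw [mul_min]
  refine le_min ?_ ?_
  · rw [mul_one]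
    refine (mul_le_of_le_one_left' (weight_le_one (by linarith) y)).trans ?_
    exact (h2.trans (mul_le_mul_right (hMle y) A)).trans le_add_self
  · rw [← riesz_mul_riesz _ _ h0, mul_left_comm]
    refine mul_le_mul' (weight_le_riesz (by linarith) le_rfl y) (h1.trans ?_)
    gcongr
    exact le_self_add

/-! ### Continuity of the potential -/

lemma lintegral_riesz_ball_sub (x : E3) {t : ℝ} (ht : 0 < t) :
    ∫⁻ y in ball x t, riesz 2 (x - y) =
      ENNReal.ofReal t * ∫⁻ z in ball (0 : E3) 1, riesz 2 z := by
  have h := lintegral_riesz_ball 2 ht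
  rw [show (3 : ℝ) - 2 = 1 by norm_num, ENNReal.rpow_one] at h
  rw [← h, ← lintegral_indicator measurableSet_ball, ← lintegral_indicator measurableSet_ball,
    ← lintegral_sub_left_eq_self _ x]
  congr 1; ext y
  simp only [Set.indicator, mem_ball, dist_eq_norm, sub_zero, sub_sub_cancel,
    sub_sub_cancel_left, norm_neg]

/-- The potential of `h` with the kernel regularised at the scale `t`, without its constant. -/
def regularized (t : ℝ) (h : E3 → Fin 4 → ℂ) (x : E3) : Fin 4 → ℂ :=
  ∫ y, alphaDot (kern t (x - y) • (x - y)) *ᵥ h y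

lemma continuous_kern_smul (t : ℝ) : Continuous fun z : E3 => kern t z • z :=
  (contDiff_kern t).continuous.smul continuous_id

lemma norm_newton (z : E3) : ‖newton z‖ = (‖z‖ ^ 2)⁻¹ := by
  rw [newton, norm_smul, Real.norm_of_nonneg (by positivity)]
  rcases eq_or_ne ‖z‖ 0 with h | h
  · simp [h]
  · field_simp

lemma norm_kern_smul_le {t : ℝ} (ht : 0 < t) (z : E3) : ‖kern t z • z‖ ≤ (t ^ 2)⁻¹ := by
  rcases le_or_gt ‖z‖ t with h | h
  · rw [kern_of_le ht h, zero_smul, norm_zero]; positivity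
  · calc ‖kern t z • z‖ ≤ ‖newton z‖ := by
          rw [newton, norm_smul, norm_smul, Real.norm_of_nonneg (kern_nonneg ht z),
            Real.norm_of_nonneg (by positivity : 0 ≤ (‖z‖ ^ 3)⁻¹)]
          exact mul_le_mul_of_nonneg_right (kern_le ht z) (norm_nonneg _)
      _ = (‖z‖ ^ 2)⁻¹ := norm_newton z
      _ ≤ (t ^ 2)⁻¹ := by gcongr

lemma continuous_regularized {t : ℝ} (ht : 0 < t) {h : E3 → Fin 4 → ℂ} (hh : Integrable h) :
    Continuous (regularized t h) := by
  refine continuous_of_dominated (bound := fun y => 12 * (t ^ 2)⁻¹ * ‖h y‖) (fun x => ?_)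
    (fun x => ae_of_all _ fun y => ?_) (hh.norm.const_mul _) (ae_of_all _ fun y => ?_)
  · exact aestronglyMeasurable_alphaDot_mulVec
      ((continuous_kern_smul t).comp (continuous_const.sub continuous_id)).measurable
      hh.aestronglyMeasurable
  · refine (norm_alphaDot_mulVec_le _ _).trans ?_
    gcongr
    exact norm_kern_smul_le ht _
  · exact (continuous_alphaDot.comp ((continuous_kern_smul t).comp
      (continuous_id.sub continuous_const))).matrix_mulVec continuous_const

lemma integrable_alphaDot_mulVec {h : E3 → Fin 4 → ℂ} (hh : AEStronglyMeasurable h volume)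
    {x : E3} (hfin : ∫⁻ y, riesz 2 (x - y) * ‖h y‖ₑ ≠ ∞) {Φ : E3 → E3} (hΦ : Measurable Φ)
    (hle : ∀ y, ‖Φ y‖ₑ ≤ riesz 2 (x - y)) : Integrable fun y => alphaDot (Φ y) *ᵥ h y := by
  refine integrable_of_enorm_le (aestronglyMeasurable_alphaDot_mulVec hΦ hh)
    (X := fun y => 12 * (riesz 2 (x - y) * ‖h y‖ₑ)) (ae_of_all _ fun y => ?_) ?_
  · refine (enorm_alphaDot_mulVec_le _ _).trans ?_
    gcongr
    exact hle y
  · rw [lintegral_const_mul' _ _ (by simp)]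
    exact ENNReal.mul_ne_top (by simp) hfin

lemma enorm_kern_smul_le {t : ℝ} (ht : 0 < t) (z : E3) : ‖kern t z • z‖ₑ ≤ riesz 2 z :=
  enorm_smul_le_of_abs_le (by rw [abs_of_nonneg (kern_nonneg ht z)]; exact kern_le ht z)

/-- The two kernels differ only within distance 2t of `x`, where |·|⁻² has integral O(t). The bound
does not depend on `x`, so the potential is a uniform limit of continuous functions. -/
lemma enorm_regularized_sub_le {h : E3 → Fin 4 → ℂ} (hh : AEStronglyMeasurable h volume)
    {B : ℝ≥0∞} (hB : B ≠ ∞) (hhB : ∀ᵐ y, ‖h y‖ₑ ≤ B)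
    (hfin : ∀ x, ∫⁻ y, riesz 2 (x - y) * ‖h y‖ₑ ≠ ∞) {t : ℝ} (ht : 0 < t) (x : E3) :
    ‖(∫ y, alphaDot (newton (x - y)) *ᵥ h y) - regularized t h x‖ₑ ≤
      12 * B * (∫⁻ z in ball (0 : E3) 1, riesz 2 z) * ENNReal.ofReal (2 * t) := by
  have i1 : Integrable fun y => alphaDot (newton (x - y)) *ᵥ h y :=
    integrable_alphaDot_mulVec hh (hfin x) (measurable_newton.comp (measurable_const_sub x))
      fun y => enorm_newton_le _
  have i2 : Integrable fun y => alphaDot (kern t (x - y) • (x - y)) *ᵥ h y :=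
    integrable_alphaDot_mulVec hh (hfin x)
      ((continuous_kern_smul t).measurable.comp (measurable_const_sub x))
      fun y => enorm_kern_smul_le ht _
  rw [regularized, ← integral_sub i1 i2]
  refine (enorm_integral_le_lintegral_enorm _).trans ?_
  rw [mul_assoc, mul_comm _ (ENNReal.ofReal (2 * t)), ← lintegral_riesz_ball_sub x (by positivity),
    ← lintegral_const_mul' _ _ (ENNReal.mul_ne_top (by simp) hB),
    ← lintegral_indicator measurableSet_ball]
  refine lintegral_mono_ae ?_
  filter_upwards [hhB] with y hy
  rw [← Matrix.sub_mulVec, ← alphaDot_sub]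
  by_cases hyx : y ∈ ball x (2 * t)
  · rw [Set.indicator_of_mem hyx]
    refine (enorm_alphaDot_mulVec_le _ _).trans ?_
    rw [mul_assoc, mul_comm B]
    gcongr
    rw [newton, ← sub_smul]
    refine enorm_smul_le_of_abs_le ?_
    rw [abs_of_nonneg (sub_nonneg.2 (kern_le ht _))]
    linarith [kern_nonneg ht (x - y)]
  · rw [Set.indicator_of_notMem hyx]
    have : 2 * t ≤ ‖x - y‖ := by
      rw [mem_ball, not_lt, dist_comm, dist_eq_norm] at hyx; exact hyx
    rw [kern_of_two_mul_le ht this, newton, sub_self]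
    simp [alphaDot]

lemma continuous_potential {h : E3 → Fin 4 → ℂ} (hh : Integrable h)
    {B : ℝ≥0∞} (hB : B ≠ ∞) (hhB : ∀ᵐ y, ‖h y‖ₑ ≤ B)
    (hfin : ∀ x, ∫⁻ y, riesz 2 (x - y) * ‖h y‖ₑ ≠ ∞) : Continuous (potential h) := by
  suffices hs : Continuous fun x => ∫ y, alphaDot (newton (x - y)) *ᵥ h y from
    hs.const_smul (-(Complex.I / (4 * (Real.pi : ℂ))))
  have hK : 12 * B * (∫⁻ z in ball (0 : E3) 1, riesz 2 z) ≠ ∞ :=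
    ENNReal.mul_ne_top (ENNReal.mul_ne_top (by simp) hB)
      (lintegral_riesz_unitBall_ne_top (by norm_num))
  have hu : TendstoUniformly (fun t : ℝ => regularized t h)
      (fun x => ∫ y, alphaDot (newton (x - y)) *ᵥ h y) (𝓝[>] 0) := by
    rw [EMetric.tendstoUniformly_iff]
    intro ε hε
    have hlim : Tendsto (fun t : ℝ => 12 * B * (∫⁻ z in ball (0 : E3) 1, riesz 2 z) *
        ENNReal.ofReal (2 * t)) (𝓝[>] 0) (𝓝 0) := by
      have h1 : Tendsto (fun t : ℝ => ENNReal.ofReal (2 * t)) (𝓝[>] 0) (𝓝 0) := by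
        have h2 : Continuous fun t : ℝ => ENNReal.ofReal (2 * t) :=
          ENNReal.continuous_ofReal.comp (continuous_const.mul continuous_id)
        have h3 := (h2.tendsto 0).mono_left (nhdsWithin_le_nhds (s := Set.Ioi 0))
        simpa using h3
      simpa using ENNReal.Tendsto.const_mul h1 (Or.inr hK)
    filter_upwards [hlim.eventually_lt_const hε, self_mem_nhdsWithin] with t h1 ht x
    rw [edist_eq_enorm_sub]
    exact (enorm_regularized_sub_le hh.aestronglyMeasurable hB hhB hfin ht x).trans_lt h1
  refine hu.continuous (Eventually.frequently ?_)
  filter_upwards [self_mem_nhdsWithin] with t ht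
  exact continuous_regularized ht hh

/-! ### Asymptotics of the potential at infinity -/

lemma newton_smul {r : ℝ} (hr : 0 < r) (z : E3) : newton (r • z) = (r ^ 2)⁻¹ • newton z := by
  rw [newton, newton, norm_smul, Real.norm_of_nonneg hr.le, smul_smul, smul_smul]
  congr 1
  rw [mul_pow, mul_inv]
  field_simp

lemma continuousAt_newton {z : E3} (hz : z ≠ 0) : ContinuousAt newton z := by
  unfold newton
  exact ((continuousAt_id.norm.pow 3).inv₀ (pow_ne_zero 3 (norm_ne_zero_iff.2 hz))).smul
    continuousAt_id

/-- By homogeneity of degree -2 the quantity is `newton` (ω - y/r), and `newton` fixes unit vectors.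
-/
lemma tendsto_sq_smul_newton {ω₀ : E3} (hω₀ : ‖ω₀‖ = 1) (s : Set E3) (y : E3) :
    Tendsto (fun p : ℝ × E3 => p.1 ^ 2 • newton (p.1 • p.2 - y)) (atTop ×ˢ 𝓝[s] ω₀) (𝓝 ω₀) := by
  have h1 : Tendsto (fun p : ℝ × E3 => p.2 - p.1⁻¹ • y) (atTop ×ˢ 𝓝[s] ω₀) (𝓝 ω₀) := by
    have ha : Tendsto (fun p : ℝ × E3 => p.2) (atTop ×ˢ 𝓝[s] ω₀) (𝓝 ω₀) :=
      tendsto_snd.mono_right nhdsWithin_le_nhds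
    have hb : Tendsto (fun p : ℝ × E3 => p.1⁻¹ • y) (atTop ×ˢ 𝓝[s] ω₀) (𝓝 ((0 : ℝ) • y)) :=
      (tendsto_inv_atTop_zero.comp tendsto_fst).smul_const y
    simpa using ha.sub hb
  have hne : ω₀ ≠ 0 := by
    intro h; simp [h] at hω₀
  have h2 := (continuousAt_newton hne).tendsto.comp h1
  have h3 : newton ω₀ = ω₀ := by simp [newton, hω₀]
  rw [h3] at h2
  refine h2.congr' ?_
  filter_upwards [tendsto_fst.eventually (eventually_gt_atTop (0 : ℝ))] with p hp
  have e : p.1 • p.2 - y = p.1 • (p.2 - p.1⁻¹ • y) := by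
    rw [smul_sub, smul_smul, mul_inv_cancel₀ hp.ne', one_smul]
  rw [e, newton_smul hp, smul_smul, mul_inv_cancel₀ (by positivity), one_smul, Function.comp]

lemma eventually_pos_and_norm_eq_one (ω₀ : E3) :
    ∀ᶠ p : ℝ × E3 in atTop ×ˢ 𝓝[sphere 0 1] ω₀, 0 < p.1 ∧ ‖p.2‖ = 1 := by
  have h1 : ∀ᶠ ω : E3 in 𝓝[sphere 0 1] ω₀, ‖ω‖ = 1 := by
    filter_upwards [self_mem_nhdsWithin] with ω hω
    simpa using hω
  exact (tendsto_fst.eventually (eventually_gt_atTop (0 : ℝ))).and (tendsto_snd.eventually h1)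

/-- For |y| < r/2 one has |rω - y| ≥ r/2, so r² times the kernel is at most 4 and dominated
convergence applies. -/
lemma tendsto_integral_near {h : E3 → Fin 4 → ℂ} (hh : Integrable h) {ω₀ : E3}
    (hω₀ : ‖ω₀‖ = 1) :
    Tendsto (fun p : ℝ × E3 => ∫ y, (ball (0 : E3) (p.1 / 2)).indicator
      (fun y => alphaDot (p.1 ^ 2 • newton (p.1 • p.2 - y)) *ᵥ h y) y)
      (atTop ×ˢ 𝓝[sphere 0 1] ω₀) (𝓝 (alphaDot ω₀ *ᵥ ∫ y, h y)) := by
  have hmeas : ∀ p : ℝ × E3, Measurable fun y => p.1 ^ 2 • newton (p.1 • p.2 - y) := fun p =>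
    (measurable_newton.comp (measurable_const_sub _)).const_smul (p.1 ^ 2)
  rw [← integral_mulVec _ hh]
  have hp := eventually_pos_and_norm_eq_one ω₀
  refine tendsto_integral_filter_of_dominated_convergence (fun y => 12 * 4 * ‖h y‖) ?_ ?_
    (hh.norm.const_mul _) (ae_of_all _ fun y => ?_)
  · exact Eventually.of_forall fun p =>
      (aestronglyMeasurable_alphaDot_mulVec (hmeas p) hh.aestronglyMeasurable).indicator
        measurableSet_ball
  · filter_upwards [hp] with p hp
    refine ae_of_all _ fun y => ?_
    by_cases hy : y ∈ ball (0 : E3) (p.1 / 2)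
    · rw [Set.indicator_of_mem hy]
      refine (norm_alphaDot_mulVec_le _ _).trans ?_
      gcongr
      have hy' : ‖y‖ < p.1 / 2 := by simpa using hy
      have hr : 0 < p.1 := hp.1
      have hz : p.1 / 2 ≤ ‖p.1 • p.2 - y‖ := by
        have := norm_sub_norm_le (p.1 • p.2) y
        rw [norm_smul, hp.2, Real.norm_of_nonneg hr.le] at this
        linarith
      rw [norm_smul, norm_newton, Real.norm_of_nonneg (by positivity)]
      calc p.1 ^ 2 * (‖p.1 • p.2 - y‖ ^ 2)⁻¹ ≤ p.1 ^ 2 * ((p.1 / 2) ^ 2)⁻¹ := by gcongr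
        _ = 4 := by field_simp; norm_num
    · rw [Set.indicator_of_notMem hy, norm_zero]; positivity
  · have hc : Continuous fun v : E3 => alphaDot v *ᵥ h y :=
      continuous_alphaDot.matrix_mulVec continuous_const
    refine ((hc.tendsto _).comp (tendsto_sq_smul_newton hω₀ (sphere 0 1) y)).congr' ?_
    filter_upwards [tendsto_fst.eventually (eventually_gt_atTop (2 * ‖y‖))] with p hp
    rw [Set.indicator_of_mem, Function.comp]
    rw [mem_ball_zero_iff]; linarith

/-- For |y| ≥ r/2, all but |y|⁻² of the decay of `h` is traded for r^(-(b-2)); the convolution bound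
supplies r⁻¹. With the factor r² this leaves r^(3-b). -/
lemma enorm_integral_far_le {h : E3 → Fin 4 → ℂ} {b : ℝ} (hb : 3 < b) {B C : ℝ≥0∞}
    (hB : B ≠ ∞) (hhB : ∀ᵐ y, ‖h y‖ₑ ≤ B * riesz b y)
    (hC : ∀ x : E3, x ≠ 0 → ∫⁻ y, riesz 2 (x - y) * riesz 2 y ≤ C * riesz 1 x)
    {r : ℝ} (hr : 0 < r) {ω : E3} (hω : ‖ω‖ = 1) :
    ‖∫ y, ((ball (0 : E3) (r / 2))ᶜ).indicator
      (fun y => alphaDot (r ^ 2 • newton (r • ω - y)) *ᵥ h y) y‖ₑ ≤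
      12 * B * C * ENNReal.ofReal (2 ^ (b - 2) * r ^ (-(b - 3))) := by
  have hr2 : 0 < r / 2 := by positivity
  have hne : r • ω ≠ 0 := by
    rw [← norm_ne_zero_iff, norm_smul, hω]
    simp [hr.ne']
  have e : ENNReal.ofReal (2 ^ (b - 2) * r ^ (-(b - 3))) =
      ENNReal.ofReal (r ^ 2) * ENNReal.ofReal ((r / 2) ^ (-(b - 2))) * riesz 1 (r • ω) := by
    rw [riesz_eq_ofReal 1 hne, norm_smul, hω, Real.norm_of_nonneg hr.le, mul_one,
      ← ENNReal.ofReal_mul (by positivity), ← ENNReal.ofReal_mul (by positivity)]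
    congr 1
    rw [Real.div_rpow hr.le (by norm_num), Real.rpow_neg (by norm_num : (0 : ℝ) ≤ 2),
      div_inv_eq_mul, mul_comm (r ^ (-(b - 2))), ← Real.rpow_natCast r 2]
    rw [show (-(b - 3)) = ((2 : ℕ) : ℝ) + -(b - 2) + -1 by push_cast; ring, Real.rpow_add hr,
      Real.rpow_add hr]
    ring
  have hK : 12 * B * (ENNReal.ofReal (r ^ 2) * ENNReal.ofReal ((r / 2) ^ (-(b - 2)))) ≠ ∞ :=
    ENNReal.mul_ne_top (ENNReal.mul_ne_top (by simp) hB)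
      (ENNReal.mul_ne_top ENNReal.ofReal_ne_top ENNReal.ofReal_ne_top)
  calc _ ≤ ∫⁻ y, 12 * B * (ENNReal.ofReal (r ^ 2) * ENNReal.ofReal ((r / 2) ^ (-(b - 2)))) *
        (riesz 2 (r • ω - y) * riesz 2 y) := by
        refine (enorm_integral_le_lintegral_enorm _).trans (lintegral_mono_ae ?_)
        filter_upwards [hhB, ae_ne_zero] with y hy hy0
        by_cases hyr : y ∈ (ball (0 : E3) (r / 2))ᶜ
        · rw [Set.indicator_of_mem hyr]
          have hyr' : r / 2 ≤ ‖y‖ := by simpa using hyr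
          have h1 : ‖r ^ 2 • newton (r • ω - y)‖ₑ ≤
              ENNReal.ofReal (r ^ 2) * riesz 2 (r • ω - y) := by
            rw [enorm_smul, Real.enorm_eq_ofReal (by positivity)]
            gcongr
            exact enorm_newton_le _
          have h2 : riesz b y ≤ ENNReal.ofReal ((r / 2) ^ (-(b - 2))) * riesz 2 y := by
            rw [show b = (b - 2) + 2 by ring, ← riesz_mul_riesz _ _ hy0]
            rw [riesz_eq_ofReal (b - 2) hy0]
            gcongr ?_ * _
            refine ENNReal.ofReal_le_ofReal ?_
            rw [show b - 2 + 2 - 2 = b - 2 by ring]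
            exact Real.rpow_le_rpow_of_nonpos hr2 hyr' (by linarith)
          calc _ ≤ 12 * (‖r ^ 2 • newton (r • ω - y)‖ₑ * ‖h y‖ₑ) := enorm_alphaDot_mulVec_le _ _
            _ ≤ 12 * ((ENNReal.ofReal (r ^ 2) * riesz 2 (r • ω - y)) *
                (B * (ENNReal.ofReal ((r / 2) ^ (-(b - 2))) * riesz 2 y))) := by
                gcongr
                exact hy.trans (by gcongr)
            _ = _ := by ring
        · rw [Set.indicator_of_notMem hyr]; simp
    _ = 12 * B * (ENNReal.ofReal (r ^ 2) * ENNReal.ofReal ((r / 2) ^ (-(b - 2)))) *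
        ∫⁻ y, riesz 2 (r • ω - y) * riesz 2 y := lintegral_const_mul' _ _ hK
    _ ≤ 12 * B * (ENNReal.ofReal (r ^ 2) * ENNReal.ofReal ((r / 2) ^ (-(b - 2)))) *
        (C * riesz 1 (r • ω)) := by
        gcongr
        exact hC _ hne
    _ = _ := by rw [e]; ring

/-- The leading asymptotics of the potential of a rapidly decaying density. -/
lemma tendstoUniformlyOn_sq_smul_potential {h : E3 → Fin 4 → ℂ} (hh : Integrable h)
    {b : ℝ} (hb : 3 < b) {B : ℝ≥0∞} (hB : B ≠ ∞) (hhB : ∀ᵐ y, ‖h y‖ₑ ≤ B * riesz b y)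
    (hfin : ∀ x, ∫⁻ y, riesz 2 (x - y) * ‖h y‖ₑ ≠ ∞) :
    TendstoUniformlyOn (fun (r : ℝ) (ω : E3) => ((r : ℂ) ^ 2) • potential h (r • ω))
      (fun ω : E3 => (-(Complex.I / (4 * (Real.pi : ℂ)))) • (alphaDot ω *ᵥ (∫ y, h y)))
      atTop (sphere (0 : E3) 1) := by
  -- Compactness of the sphere reduces uniformity to joint limits as r → ∞ and ω → ω₀.
  rw [← tendstoLocallyUniformlyOn_iff_tendstoUniformlyOn_of_compact (isCompact_sphere _ _),
    tendstoLocallyUniformlyOn_iff_forall_tendsto]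
  intro ω₀ hω₀
  have hω₀' : ‖ω₀‖ = 1 := by simpa using hω₀
  obtain ⟨C, hC, hCle⟩ := exists_lintegral_riesz_two_mul_riesz_two_le
  have hp := eventually_pos_and_norm_eq_one ω₀
  have hfar : Tendsto (fun p : ℝ × E3 => ∫ y, ((ball (0 : E3) (p.1 / 2))ᶜ).indicator
      (fun y => alphaDot (p.1 ^ 2 • newton (p.1 • p.2 - y)) *ᵥ h y) y)
      (atTop ×ˢ 𝓝[sphere 0 1] ω₀) (𝓝 0) := by
    rw [tendsto_zero_iff_enorm_tendsto_zero]
    have hlim : Tendsto (fun p : ℝ × E3 =>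
        12 * B * C * ENNReal.ofReal (2 ^ (b - 2) * p.1 ^ (-(b - 3))))
        (atTop ×ˢ 𝓝[sphere 0 1] ω₀) (𝓝 0) := by
      have h1 : Tendsto (fun r : ℝ => ENNReal.ofReal (2 ^ (b - 2) * r ^ (-(b - 3)))) atTop
          (𝓝 0) := by
        have h2 := (tendsto_rpow_neg_atTop (show 0 < b - 3 by linarith)).const_mul
          ((2 : ℝ) ^ (b - 2))
        simpa using ENNReal.tendsto_ofReal h2
      have h3 := ENNReal.Tendsto.const_mul (a := 12 * B * C) (h1.comp
        (tendsto_fst (f := atTop) (g := 𝓝[sphere 0 1] ω₀)))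
        (Or.inr (ENNReal.mul_ne_top (ENNReal.mul_ne_top (by simp) hB) hC))
      simpa using h3
    refine tendsto_of_tendsto_of_tendsto_of_le_of_le' tendsto_const_nhds hlim
      (Eventually.of_forall fun _ => zero_le) ?_
    filter_upwards [hp] with p hp
    exact enorm_integral_far_le hb hB hhB hCle hp.1 hp.2
  have hsum := ((tendsto_integral_near hh hω₀').add hfar).const_smul
    (-(Complex.I / (4 * (Real.pi : ℂ))))
  rw [add_zero] at hsum
  have hF : Tendsto (fun p : ℝ × E3 => ((p.1 : ℂ) ^ 2) • potential h (p.1 • p.2))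
      (atTop ×ˢ 𝓝[sphere 0 1] ω₀)
      (𝓝 ((-(Complex.I / (4 * (Real.pi : ℂ)))) • (alphaDot ω₀ *ᵥ (∫ y, h y)))) := by
    refine hsum.congr fun p => ?_
    have hi := integrable_alphaDot_mulVec hh.aestronglyMeasurable (hfin (p.1 • p.2))
      (measurable_newton.comp (measurable_const_sub _)) fun y => enorm_newton_le _
    have hi2 : Integrable fun y => alphaDot (p.1 ^ 2 • newton (p.1 • p.2 - y)) *ᵥ h y := by
      simp only [alphaDot_smul, Matrix.smul_mulVec]
      exact hi.smul ((p.1 ^ 2 : ℝ) : ℂ)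
    rw [integral_indicator measurableSet_ball, integral_indicator measurableSet_ball.compl,
      integral_add_compl measurableSet_ball hi2, potential]
    simp only [alphaDot_smul, Matrix.smul_mulVec]
    rw [integral_smul, smul_comm]
    push_cast
    rfl
  have hL : Tendsto (fun p : ℝ × E3 =>
      (-(Complex.I / (4 * (Real.pi : ℂ)))) • (alphaDot p.2 *ᵥ (∫ y, h y)))
      (atTop ×ˢ 𝓝[sphere 0 1] ω₀)
      (𝓝 ((-(Complex.I / (4 * (Real.pi : ℂ)))) • (alphaDot ω₀ *ᵥ (∫ y, h y)))) := by
    have hc : Continuous fun v : E3 =>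
        (-(Complex.I / (4 * (Real.pi : ℂ)))) • (alphaDot v *ᵥ (∫ y, h y)) :=
      (continuous_alphaDot.matrix_mulVec continuous_const).const_smul
        (-(Complex.I / (4 * (Real.pi : ℂ))))
    exact (hc.tendsto ω₀).comp (tendsto_snd.mono_right nhdsWithin_le_nhds)
  exact (hL.prodMk_nhds hF).mono_right (nhds_le_uniformity _)

end ZeroMode

end

/-! ### The main theorem -/

/-- Elements of `H¹` are functions up to equality almost everywhere, so the pointwise values
`f(rω)` are those of the continuous representative `g`, whose existence is part of the claim. -/
theorem theorem1p1 (Q : ZeroMode.E3 → Matrix (Fin 4) (Fin 4) ℂ) (C ρ : ℝ) (hρ : 1 < ρ)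
    (hQmeas : ∀ j k, AEMeasurable (fun x => Q x j k) volume)
    (hQherm : ∀ x, (Q x).IsHermitian)
    (hQdecay : ∀ x j k, ‖Q x j k‖ ≤ C * ZeroMode.bracket x ^ (-ρ))
    (f : ZeroMode.E3 → Fin 4 → ℂ) (hf : ZeroMode.IsZeroMode Q f) :
    Integrable (fun y => Q y *ᵥ f y) volume ∧
    ∃ g : ZeroMode.E3 → Fin 4 → ℂ, Continuous g ∧ g =ᵐ[volume] f ∧
      TendstoUniformlyOn
        (fun (r : ℝ) (ω : ZeroMode.E3) => ((r : ℂ) ^ 2) • g (r • ω))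
        (fun ω : ZeroMode.E3 => (-(Complex.I / (4 * (Real.pi : ℂ)))) •
          (ZeroMode.alphaDot ω *ᵥ (∫ y, Q y *ᵥ f y)))
        atTop (Metric.sphere (0 : ZeroMode.E3) 1) := by
  open ZeroMode ENNReal in
  obtain ⟨hH1, Df, hD, heq⟩ := hf
  have hfm : AEStronglyMeasurable f volume :=
    (aemeasurable_pi_lambda _ fun k => (hH1 k).1.aestronglyMeasurable.aemeasurable)
      |>.aestronglyMeasurable
  have hfL2 : MemLp f 2 volume := MemLp.of_eval fun k => (hH1 k).1
  have hfloc : LocallyIntegrable f := hfL2.locallyIntegrable (by norm_num)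
  have hf2 : Integrable fun y => ‖f y‖ ^ 2 := by
    simpa using hfL2.integrable_norm_pow (by norm_num)
  have hhm : AEStronglyMeasurable (fun y => Q y *ᵥ f y) volume := by
    refine (aemeasurable_pi_lambda _ fun k => ?_).aestronglyMeasurable
    change AEMeasurable (fun y => ∑ l, Q y k l * f y l) volume
    refine Finset.aemeasurable_fun_sum _ fun l _ => ?_
    exact (hQmeas k l).mul (hH1 l).1.aestronglyMeasurable.aemeasurable
  have hhle : ∀ y, ‖Q y *ᵥ f y‖ₑ ≤ ENNReal.ofReal (4 * C) * (weight ρ y * ‖f y‖ₑ) := by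
    intro y
    have hb : 0 < bracket y ^ (-ρ) := Real.rpow_pos_of_pos (by linarith [one_le_bracket y]) _
    have hC : 0 ≤ C := by
      have := (norm_nonneg _).trans (hQdecay y 0 0)
      exact nonneg_of_mul_nonneg_left this hb
    rw [weight, ← ofReal_norm, ← ofReal_norm, ← ENNReal.ofReal_mul hb.le,
      ← ENNReal.ofReal_mul (by positivity)]
    refine ENNReal.ofReal_le_ofReal ((norm_mulVec_le (hQdecay y) (f y)).trans (le_of_eq ?_))
    ring
  have heq' : ∀ᵐ x, 0 = (∑ j : Fin 3, alpha j *ᵥ ((1 / Complex.I) • Df j x)) + Q x *ᵥ f x := heq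
  have hpt : ∀ x, ∫⁻ y, riesz 2 (x - y) * ‖Q y *ᵥ f y‖ₑ ≤
      ENNReal.ofReal (4 * C) * ∫⁻ y, riesz 2 (x - y) * (weight ρ y * ‖f y‖ₑ) := by
    intro x
    rw [← lintegral_const_mul' _ _ ENNReal.ofReal_ne_top]
    refine lintegral_mono fun y => ?_
    rw [mul_left_comm]
    gcongr
    exact hhle y
  have hA : 12 * ENNReal.ofReal (4 * C) ≠ ∞ := ENNReal.mul_ne_top (by simp) ENNReal.ofReal_ne_top
  have hu : ∀ᵐ x, ‖f x‖ₑ ≤ 12 * ENNReal.ofReal (4 * C) *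
      ∫⁻ y, riesz 2 (x - y) * (weight ρ y * ‖f y‖ₑ) := by
    filter_upwards [ae_enorm_le_lintegral hD heq' hfloc hf2] with x hx
    rw [mul_assoc]
    -- This closes the inequality on |f| alone, before the potential of Qf is known to be finite.
    exact hx.trans (mul_le_mul_right (hpt x) _)
  have hu2 : ∫⁻ y, ‖f y‖ₑ ^ 2 ≠ ∞ := by
    have := hf2.2
    simpa [HasFiniteIntegral, enorm_pow] using this.ne
  have hM := exists_lintegral_riesz_weight_le hρ hfm.enorm hu2 hA hu
  have hfin : ∀ x, ∫⁻ y, riesz 2 (x - y) * ‖Q y *ᵥ f y‖ₑ ≠ ∞ := by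
    obtain ⟨M, hM, hMle⟩ := hM
    intro x
    exact ne_top_of_le_ne_top (ENNReal.mul_ne_top ENNReal.ofReal_ne_top hM)
      ((hpt x).trans (mul_le_mul_right (hMle x) _))
  obtain ⟨b, hb, B, hB, hBle⟩ := exists_weight_mul_le hρ hA hu hM
  have hB' : ENNReal.ofReal (4 * C) * B ≠ ∞ := ENNReal.mul_ne_top ENNReal.ofReal_ne_top hB
  have hhB : ∀ᵐ y, ‖Q y *ᵥ f y‖ₑ ≤ ENNReal.ofReal (4 * C) * B * min 1 (riesz b y) := by
    filter_upwards [hBle] with y hy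
    rw [mul_assoc]
    exact (hhle y).trans (mul_le_mul_right hy _)
  have hhI : Integrable (fun y => Q y *ᵥ f y) volume := by
    refine integrable_of_enorm_le hhm hhB ?_
    rw [lintegral_const_mul' _ _ hB']
    exact ENNReal.mul_ne_top hB' (lintegral_min_riesz_ne_top hb)
  refine ⟨hhI, potential fun y => Q y *ᵥ f y, continuous_potential hhI hB' ?_ hfin,
    ae_eq_potential hD heq' hfloc hf2 hhm hfin,
    tendstoUniformlyOn_sq_smul_potential hhI hb hB' ?_ hfin⟩
  · filter_upwards [hhB] with y hy
    exact hy.trans (mul_le_of_le_one_right' (min_le_left _ _))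
  · filter_upwards [hhB] with y hy
    exact hy.trans (mul_le_mul_right (min_le_right _ _) _)
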